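/- **Setting.** Let $N=\mathbb Z^n$, $M=\operatorname{Hom}(N,\mathbb Z)$, and for a set $P$ in $M_{\mathbb R}$ or $N_{\mathbb R}$ let $P^*=\{m \mid \langle m,w\rangle\ge -1\ \forall w\in P\}$. Let $\Delta\subset M_{\mathbb R}$ be a reflexive polytope of dimension $n$ ($\Delta$ and $\Delta^*$ are lattice polytopes with $0$ in the interior), let $\Sigma$ be its normal fan, that is, the fan over the faces of $\Delta^*$, let $\Sigma(1)$ be its set of rays (identified with their minimal lattice generators, the vertices of $\Delta^*$), let $Y=\mathbb P(\Delta)$ be the toric variety, and let $S=\mathbb C[x_r\mid r\in\Sigma(1)]$ be its Cox ring, graded by the class group, with irrelevant ideal $B(\Sigma)$. Let $\Sigma(1)=J_1\sqcup\dots\sqcup J_c$ be a nef partition: each divisor $E_j=\sum_{r\in J_j}D_r$ is Cartier and spanned by global sections. Let $\Delta_j\subset M_{\mathbb R}$ be the convex hull of the lattice points $m\in M$ with $\langle m,r\rangle\ge -1$ for $r\in J_j$ and $\langle m,r\rangle\ge 0$ for $r\in\Sigma(1)\setminus J_j$ (the polytope of sections of $E_j$). Put $$m_j=\prod_{r\in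 J_j}x_r,\qquad I_0=\langle m_1,\dots,m_c\rangle\subset S .$$ Let $g_j\in S_{[E_j]}$ be a linear combination, with all coefficients non-zero but otherwise arbitrary, of the monomials of degree $[E_j]$ that do not lie in $I_0$, and let $$I=\langle t\,g_j+m_j\mid j=1,\dots,c\rangle\subset\mathbb C[t]\otimes S .$$ **The Gröbner cone.** Weights $(w_t,(w_r)_r)$ on the variables of $\mathbb C[t]\otimes S$ are mapped to $\mathbb R\oplus N_{\mathbb R}$ by $(w_t,w)\mapsto(w_t,\sum_r w_r\,r)$. Fix a monomial ordering $>$ on $\mathbb C[t]\otimes S$ with $t<1$. The closed cone $C_{I_0}(I)\subset\mathbb R\oplus N_{\mathbb R}$ is the closure of the set of the negatives of the images of those weights $w$ for which the lead ideal of $I$ with respect to the weight ordering by $w$ refined by $>$ (larger weight is larger) is generated by $I_0$. Let $\nabla_{I_0}(I)=\{w_x\in N_{\mathbb R}\mid(1,w_x)\in C_{I_0}(I)\}$, and for $F\subset\nabla_{I_0}(I)$ let $F^*=\{m\in\nabla_{I_0}(I)^*\mid\langle m,w\rangle=-1\ \forall w\in F\}$. **The tropical complex.** Let $L$ be the valued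 field of series $\sum_q\alpha_q s^q$ with $\alpha_q\in\mathbb C$, real exponents and well-ordered support. The Bergman fan $BF(I)\subset\mathbb R\oplus N_{\mathbb R}$ is the set of all $(\operatorname{val}(t),\sum_r\operatorname{val}(x_r)\,r)$, where $(t,(x_r)_r)$ runs over the zeros of $I$ with all coordinates in $L\setminus\{0\}$. The special fiber tropical complex $T_{I_0}(I)\subset\partial\nabla_{I_0}(I)$ consists of the non-empty slices $\{w_x\mid(1,w_x)\in C\}$ of the proper faces $C$ of $C_{I_0}(I)$ that are contained in $BF(I)$. Put $T_{I_0}(I)^*=\{F^*\mid F\in T_{I_0}(I)\}$. **Strata.** Let $\operatorname{Strata}_\Delta(I_0)\subset\partial\Delta$ be the complex of the non-empty proper faces $G$ of $\Delta$ whose toric stratum in $Y$ is contained in the subscheme defined by $I_0$, that is, with $I_0\subset\langle x_r\mid \langle m,r\rangle=-1\ \forall m\in G\rangle$. **Theorem.** The maps $$T_{I_0}(I)\to T_{I_0}(I)^*\to\operatorname{Strata}_\Delta(I_0),\qquad F\mapsto F^*\mapsto\sum_{i=1}^c\,(F^*\cap\Delta_i)$$ (Minkowski sum) are well defined bijections.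 The first one reverses inclusions, the second one preserves them, and the composite reverses them, in each case in both directions (for $F_1,F_2\in T_{I_0}(I)$ one has $F_1\subset F_2$ if and only if the image of $F_2$ is contained in that of $F_1$, and similarly for the second map). In particular $T_{I_0}(I)$ is dual, as a complex, to $\operatorname{Strata}_\Delta(I_0)$. -/

import Mathlib

open scoped Pointwise

noncomputable section

/-! ### Lattice polytopes, duals and faces

The lattices are `N = M = ℤⁿ`, the real spaces `N_ℝ = M_ℝ = ℝⁿ`, and the pairing between `M_ℝ`
and `N_ℝ` is the dot product. -/

/-- The inclusion of the lattice `ℤⁿ` into `ℝⁿ`. -/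
def realVec {n : ℕ} (v : Fin n → ℤ) : Fin n → ℝ := fun i => (v i : ℝ)

/-- An integral polytope: the convex hull of finitely many lattice points. -/
def IsLatticePolytope {n : ℕ} (P : Set (Fin n → ℝ)) : Prop :=
  ∃ V : Finset (Fin n → ℤ), P = convexHull ℝ (realVec '' (V : Set (Fin n → ℤ)))

/-- The dual `P* = {m | ⟨m, w⟩ ≥ -1 for all w ∈ P}`. -/
def polarDual {n : ℕ} (P : Set (Fin n → ℝ)) : Set (Fin n → ℝ) :=
  {m | ∀ w ∈ P, -1 ≤ m ⬝ᵥ w}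

/-- The dual face `F* = {m ∈ P* | ⟨m, w⟩ = -1 for all w ∈ F}` of a face `F` of `P`. -/
def dualFace {n : ℕ} (P F : Set (Fin n → ℝ)) : Set (Fin n → ℝ) :=
  {m ∈ polarDual P | ∀ w ∈ F, m ⬝ᵥ w = -1}

/-- `F` is a non-empty proper face of the polyhedron `P`, that is, a non-empty boundary face of a
full-dimensional `P`. -/
def IsBoundaryFace {E : Type*} [AddCommGroup E] [Module ℝ E] [TopologicalSpace E]
    (P F : Set E) : Prop :=
  IsExposed ℝ P F ∧ F.Nonempty ∧ F ≠ P

/-- A reflexive polytope `Δ ⊂ M_ℝ` of dimension `n`: both `Δ` and `Δ*` are integral and contain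
`0` in their interior. -/
structure ReflexivePolytope (n : ℕ) where
  carrier : Set (Fin n → ℝ)
  isLatticePolytope : IsLatticePolytope carrier
  isLatticePolytope_dual : IsLatticePolytope (polarDual carrier)
  zero_mem_interior : 0 ∈ interior carrier
  zero_mem_interior_dual : 0 ∈ interior (polarDual carrier)

/-! ### Monomial orderings, lead ideals and the Bergman fan -/

/-- A monomial ordering, not necessarily a well-ordering: a strict total order on the exponent
vectors that is compatible with multiplication of monomials. -/
structure IsMonomialOrdering {σ : Type*} (lt : (σ →₀ ℕ) → (σ →₀ ℕ) → Prop) : Prop where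
  irrefl : ∀ a, ¬ lt a a
  trans : ∀ a b c, lt a b → lt b c → lt a c
  total : ∀ a b, lt a b ∨ a = b ∨ lt b a
  add_right : ∀ a b c, lt a b → lt (a + c) (b + c)

/-- The weight ordering by `w`, refined by `lt`. -/
def weightOrdering {σ : Type*} (w : σ → ℝ) (lt : (σ →₀ ℕ) → (σ →₀ ℕ) → Prop)
    (a b : σ →₀ ℕ) : Prop :=
  (a.sum fun i k => (k : ℝ) * w i) < (b.sum fun i k => (k : ℝ) * w i) ∨
    ((a.sum fun i k => (k : ℝ) * w i) = (b.sum fun i k => (k : ℝ) * w i) ∧ lt a b)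

/-- The lead ideal of `I`: the ideal generated by the lead monomials of the non-zero elements of
`I`. -/
def leadIdeal {σ : Type*} (lt : (σ →₀ ℕ) → (σ →₀ ℕ) → Prop) (I : Ideal (MvPolynomial σ ℂ)) :
    Ideal (MvPolynomial σ ℂ) :=
  Ideal.span {p | ∃ f ∈ I, ∃ e ∈ f.support, (∀ e' ∈ f.support, e' ≠ e → lt e' e) ∧
    p = MvPolynomial.monomial e 1}

namespace ReflexivePolytope

variable {n : ℕ} (Δ : ReflexivePolytope n)

/-- The rays of the normal fan `Σ` of `Δ`, given by their minimal lattice generators: these are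
the vertices of `Δ*`, since `Σ` is the fan over the faces of `Δ*`. -/
def Ray : Type :=
  {v : Fin n → ℤ // realVec v ∈ (polarDual Δ.carrier).extremePoints ℝ}

/-- The minimal lattice generator of a ray, as a vector of `N = ℤⁿ`. -/
def Ray.gen {Δ : ReflexivePolytope n} (r : Δ.Ray) : Fin n → ℤ := r.1

instance : Finite Δ.Ray := by
  obtain ⟨V, hV⟩ := Δ.isLatticePolytope_dual
  have hinj : Function.Injective (realVec : (Fin n → ℤ) → Fin n → ℝ) := by
    intro a b h
    funext i
    have := congrFun h i
    simpa [realVec] using this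
  have hsub : {v : Fin n → ℤ | realVec v ∈ (polarDual Δ.carrier).extremePoints ℝ} ⊆
      (V : Set (Fin n → ℤ)) := by
    intro v hv
    have hv' : realVec v ∈ (convexHull ℝ (realVec '' (V : Set (Fin n → ℤ)))).extremePoints ℝ := by
      rw [← hV]
      exact hv
    obtain ⟨u, hu, huv⟩ := extremePoints_convexHull_subset hv'
    exact hinj huv ▸ hu
  exact (V.finite_toSet.subset hsub).to_subtype

instance : Fintype Δ.Ray := Fintype.ofFinite _

/-! ### The Cox ring and torus invariant divisors

A torus invariant Weil divisor `∑ a_r D_r` on the toric variety `Y` of `Σ` is its coefficient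
function `a : Δ.Ray → ℤ`. The cones of `Σ` are the cones over the proper faces of `Δ*`, so
they are indexed by these faces; the rays of a cone are those whose generators lie in the face. -/

/-- The index set of the cones of `Σ`: the proper faces of `Δ*`, with the empty face for the cone
`0`. -/
def coneFaces : Set (Set (Fin n → ℝ)) :=
  {F | IsExposed ℝ (polarDual Δ.carrier) F ∧ F ≠ polarDual Δ.carrier}

/-- The Cox ring `S = ℂ[x_r | r ∈ Σ(1)]` of `Y`. -/
abbrev CoxRing : Type := MvPolynomial Δ.Ray ℂ

open Classical in
/-- The irrelevant ideal `B(Σ)`. -/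
def irrelevantIdeal : Ideal Δ.CoxRing :=
  Ideal.span {p | ∃ F ∈ Δ.coneFaces,
    p = ∏ r : Δ.Ray with realVec r.gen ∉ F, MvPolynomial.X r}

variable {Δ} in
/-- The Cox monomial `x ^ e` has degree `[D]`: its exponent vector differs from `D` by an element
`A(m) = (⟨m, r⟩)_r` with `m ∈ M`. -/
def HasDegree (D : Δ.Ray → ℤ) (e : Δ.Ray →₀ ℕ) : Prop :=
  ∃ m : Fin n → ℤ, ∀ r, (e r : ℤ) = m ⬝ᵥ r.gen + D r

variable {Δ} in
/-- `f` lies in the graded part `S_[D] ≅ H⁰(Y, 𝒪(D))` of the Cox ring. -/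
def IsSection (D : Δ.Ray → ℤ) (f : Δ.CoxRing) : Prop :=
  ∀ e ∈ f.support, HasDegree D e

variable {Δ} in
/-- `D` is Cartier: on every chart `U_σ` it is the divisor of a character. -/
def IsCartier (D : Δ.Ray → ℤ) : Prop :=
  ∀ F ∈ Δ.coneFaces, ∃ m : Fin n → ℤ,
    ∀ r : Δ.Ray, realVec r.gen ∈ F → m ⬝ᵥ r.gen = -D r

variable {Δ} in
/-- `𝒪(D)` is spanned by global sections: at every point of `Y`, given by Cox coordinates
`x ∈ ℂ^Σ(1) ∖ V(B(Σ))`, some section in `S_[D]` does not vanish. -/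
def IsSpanned (D : Δ.Ray → ℤ) : Prop :=
  ∀ x : Δ.Ray → ℂ, (∃ b ∈ Δ.irrelevantIdeal, MvPolynomial.eval x b ≠ 0) →
    ∃ f : Δ.CoxRing, IsSection D f ∧ MvPolynomial.eval x f ≠ 0

variable {Δ} in
/-- The polytope of sections `Δ_D ⊂ M_ℝ`: the convex hull of the torus invariant sections. -/
def sectionPolytope (D : Δ.Ray → ℤ) : Set (Fin n → ℝ) :=
  convexHull ℝ (realVec '' {m : Fin n → ℤ | ∀ r : Δ.Ray, -D r ≤ m ⬝ᵥ r.gen})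

/-! ### Nef partitions and the canonical degeneration

A decomposition `Σ(1) = J_1 ∪ … ∪ J_c` into disjoint subsets is given by the function
`J : Δ.Ray → Fin c` with `J_j = J⁻¹(j)`. -/

variable {Δ} {c : ℕ}

/-- The divisor `E_j = ∑_{r ∈ J_j} D_r`. -/
def partDivisor (J : Δ.Ray → Fin c) (j : Fin c) : Δ.Ray → ℤ :=
  fun r => if J r = j then 1 else 0

/-- `Σ(1) = J_1 ∪ … ∪ J_c` is a nef partition. -/
def IsNefPartition (J : Δ.Ray → Fin c) : Prop :=
  ∀ j, IsCartier (partDivisor J j) ∧ IsSpanned (partDivisor J j)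

/-- The monomial `m_j = ∏_{r ∈ J_j} x_r`. -/
def partMonomial (J : Δ.Ray → Fin c) (j : Fin c) : Δ.CoxRing :=
  ∏ r : Δ.Ray with J r = j, MvPolynomial.X r

/-- The monomial special fibre ideal `I_0 = ⟨m_1, …, m_c⟩ ⊂ S`. -/
def specialFibreIdeal (J : Δ.Ray → Fin c) : Ideal Δ.CoxRing :=
  Ideal.span (Set.range (partMonomial J))

/-- `g` is a general linear combination of those monomials of degree `[E_j]` that are not in
`I_0`: precisely these monomials occur in `g` with non-zero coefficient. -/
def IsGeneralSection (J : Δ.Ray → Fin c) (j : Fin c) (g : Δ.CoxRing) : Prop :=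
  ∀ e : Δ.Ray →₀ ℕ, e ∈ g.support ↔
    HasDegree (partDivisor J j) e ∧ MvPolynomial.monomial e (1 : ℂ) ∉ specialFibreIdeal J

variable (Δ) in
/-- The ring `ℂ[t] ⊗ S`; the variable `none` is `t` and `some r` is `x_r`. -/
abbrev FamilyRing : Type := MvPolynomial (Option Δ.Ray) ℂ

/-- The inclusion `S → ℂ[t] ⊗ S`. -/
def toFamily : Δ.CoxRing →ₐ[ℂ] Δ.FamilyRing := MvPolynomial.rename some

/-- The ideal `I = ⟨t g_j + m_j | j = 1, …, c⟩ ⊂ ℂ[t] ⊗ S` of the canonical degeneration. -/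
def degenerationIdeal (J : Δ.Ray → Fin c) (g : Fin c → Δ.CoxRing) : Ideal Δ.FamilyRing :=
  Ideal.span (Set.range fun j =>
    MvPolynomial.X none * toFamily (g j) + toFamily (partMonomial J j))

/-! ### The special fibre tropical complex -/

/-- The projection of the weights `(w_t, (w_r)_r)` on the variables of `ℂ[t] ⊗ S` to `ℝ ⊕ N_ℝ`.
On the second factor this is the quotient map of `Hom(ℝ^Σ(1), ℝ)` by `Hom(A_{n-1}(Y) ⊗ ℝ, ℝ)`,
followed by the identification of the quotient with `N_ℝ`. -/
def weightProj (w : Option Δ.Ray → ℝ) : ℝ × (Fin n → ℝ) :=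
  (w none, ∑ r : Δ.Ray, w (some r) • realVec r.gen)

/-- The Gröbner cone `C_{I_0}(I)` of special fibre weights: the closed cone of all
`-(w_t, w_x)` for which the lead ideal of `I` with respect to the weight ordering by
`(w_t, w_x)`, refined by `lt`, is `I_0`. -/
def groebnerCone (lt : (Option Δ.Ray →₀ ℕ) → (Option Δ.Ray →₀ ℕ) → Prop)
    (I₀ : Ideal Δ.CoxRing) (I : Ideal Δ.FamilyRing) : Set (ℝ × (Fin n → ℝ)) :=
  closure {u | ∃ w : Option Δ.Ray → ℝ, u = -weightProj w ∧
    leadIdeal (weightOrdering w lt) I = I₀.map (toFamily : Δ.CoxRing →ₐ[ℂ] Δ.FamilyRing)}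

/-- The polytope of special fibre weights `∇_{I_0}(I) = C_{I_0}(I) ∩ {w_t = 1} ⊂ N_ℝ`. -/
def weightPolytope (lt : (Option Δ.Ray →₀ ℕ) → (Option Δ.Ray →₀ ℕ) → Prop)
    (I₀ : Ideal Δ.CoxRing) (I : Ideal Δ.FamilyRing) : Set (Fin n → ℝ) :=
  {w | ((1 : ℝ), w) ∈ groebnerCone lt I₀ I}

/-- The Bergman fan `BF(I) ⊂ ℝ ⊕ N_ℝ`: the image of the zeros of `I` with non-zero coordinates
under the valuation map, modulo the lineality space `Hom(A_{n-1}(Y) ⊗ ℝ, ℝ)`. The field consists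
of the series `∑ α_q s^q` with real exponents and well-ordered support, with
`val = min of the support`. -/
def bergmanFan (I : Ideal Δ.FamilyRing) : Set (ℝ × (Fin n → ℝ)) :=
  {u | ∃ p : Option Δ.Ray → HahnSeries ℝ ℂ, (∀ i, p i ≠ 0) ∧
    (∀ f ∈ I, MvPolynomial.aeval p f = 0) ∧ u = weightProj fun i => (p i).order}

/-- The fan `BF_{I_0}(I)` of the tropical faces of `C_{I_0}(I)`: its proper faces that are
contained in the Bergman fan. -/
def tropicalFaces (lt : (Option Δ.Ray →₀ ℕ) → (Option Δ.Ray →₀ ℕ) → Prop)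
    (I₀ : Ideal Δ.CoxRing) (I : Ideal Δ.FamilyRing) : Set (Set (ℝ × (Fin n → ℝ))) :=
  {C | IsBoundaryFace (groebnerCone lt I₀ I) C ∧ C ⊆ bergmanFan I}

/-- The special fibre tropical complex `T_{I_0}(I) ⊂ ∂∇_{I_0}(I)`: the non-empty intersections of
the cones of `BF_{I_0}(I)` with the hyperplane `{w_t = 1}`. -/
def tropicalComplex (lt : (Option Δ.Ray →₀ ℕ) → (Option Δ.Ray →₀ ℕ) → Prop)
    (I₀ : Ideal Δ.CoxRing) (I : Ideal Δ.FamilyRing) : Set (Set (Fin n → ℝ)) :=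
  {F | F.Nonempty ∧ ∃ C ∈ tropicalFaces lt I₀ I, F = {w | ((1 : ℝ), w) ∈ C}}

/-- The complex `Strata_Δ(I_0) ⊂ ∂Δ` of the toric strata of the subscheme of `Y` defined by
`I_0`. The stratum of a face `G` of `Δ` is defined by the ideal generated by the variables `x_r`
for which the facet `{⟨·, r⟩ = -1}` of `Δ` contains `G`. -/
def strata (I₀ : Ideal Δ.CoxRing) : Set (Set (Fin n → ℝ)) :=
  {G | IsBoundaryFace Δ.carrier G ∧
    I₀ ≤ Ideal.span {x | ∃ r : Δ.Ray, (∀ m ∈ G, m ⬝ᵥ realVec r.gen = -1) ∧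
      x = MvPolynomial.X r}}

/-- The map `E ↦ ∑_j (E ∩ Δ_j)` (Minkowski sum), where `Δ_j = Δ_{E_j}`. -/
def minkowskiMap (J : Δ.Ray → Fin c) (E : Set (Fin n → ℝ)) : Set (Fin n → ℝ) :=
  ∑ j, (E ∩ sectionPolytope (partDivisor J j))

end ReflexivePolytope

end

/-! Everything reduces to inequalities between weights and lattice points of the Δ_j. Call a lattice
point of Δ_j general if its Cox monomial lies outside I_0. As t, m_1, …, m_c is a regular sequence
of monomials, the generators t g_j + m_j form a standard basis as soon as each m_j is the lead term.
Hence the Gröbner cone is `specialCone`, cut out by u_t + ⟨m, u_x⟩ ≥ 0 for general m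
(`groebnerCone_eq`).

A zero of I with weight (1, w) in this cone forces a second term of minimal weight in each t g_j +
m_j, that is, a general m in Δ_j with ⟨m, w⟩ = -1. The central point is
`IsTropicalPoint.exists_isPartWeight`: nefness makes every such w a combination ∑ a_r r with a ≥ 0
and ∑_{r ∈ J_j} a_r = 1 for each j. Hence w ≥ -1 on all of Δ_j, with equality exactly at the points
that are tight on every ray with a_r ≠ 0, and every part contains such a ray. Since Δ = ∑ Δ_j
(`exists_sum_eq`), the Minkowski sum of the F* ∩ Δ_j is the face of Δ on which all w in F take their
minimum -c (`minkowskiMap_eq`), and the rays with a_r ≠ 0 show that it is a stratum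
(`face_mem_strata`).

Conversely, for a stratum G, equal weights on the rays of each J_j whose facets contain G give a
suitable w (`exists_isTropicalPoint_of_mem_strata`). The smallest face of the cone through (1, w)
lies in the Bergman fan: at non-zero multiples of tropical points, the lowest terms of the g_j avoid
one chosen variable of each part, in which m_j is linear, so these variables can be solved for and
the solution lifted to series by iteration (`mem_bergmanFan`). Finally, the general points tight on
a slice are read off from its face of Δ by exchanging one Minkowski summand, and they determine the
slice (`subset_of_subset`). -/

noncomputable section

/-! ### Standard bases for perturbations of coprime monomials. -/

section Groebner

/-- Relations among the `m j` modulo `t` are generated by Koszul relations, and these lift to the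
elements `t * g j + m j`. When `t` can be cancelled, this says that the quotient by their span has
no `t`-torsion. -/
theorem Finset.sum_mul_add_mem_smul_span {R ι : Type*} [CommRing R] [DecidableEq ι] (t : R)
    (m g : ι → R)
    (hreg : ∀ (K : Finset ι), ∀ k ∉ K, ∀ a : R, a * m k ∈ Ideal.span (insert t (m '' K)) →
      a ∈ Ideal.span (insert t (m '' K)))
    (K : Finset ι) : ∀ a : ι → R, t ∣ ∑ j ∈ K, a j * m j →
      ∃ b ∈ Ideal.span (Set.range fun j => t * g j + m j),
        ∑ j ∈ K, a j * (t * g j + m j) = t * b := by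
  induction K using Finset.induction_on with
  | empty => intro a _; exact ⟨0, Ideal.zero_mem _, by simp⟩
  | insert k K hk ih =>
    intro a ha
    rw [Finset.sum_insert hk] at ha ⊢
    have h1 : a k * m k ∈ Ideal.span (insert t (m '' K)) := by
      obtain ⟨q, hq⟩ := ha
      have : a k * m k = q * t - ∑ j ∈ K, a j * m j := by rw [mul_comm q, ← hq]; ring
      rw [this]
      refine Ideal.sub_mem _ (Ideal.mul_mem_left _ _ (Ideal.subset_span (Set.mem_insert _ _))) ?_
      exact Ideal.sum_mem _ fun j hj => Ideal.mul_mem_left _ _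
        (Ideal.subset_span (Set.mem_insert_of_mem _ ⟨j, hj, rfl⟩))
    have h2 := hreg K k hk _ h1
    obtain ⟨b, z, hz, hab⟩ := Ideal.mem_span_insert.1 h2
    obtain ⟨γ, hγ⟩ := (Submodule.mem_span_image_finset_iff_exists_fun R).1 hz
    obtain ⟨β, hβ'⟩ : ∃ β : ι → R, ∑ j ∈ K, β j * m j = z := by
      refine ⟨fun j => if h : j ∈ K then γ ⟨j, h⟩ else 0, ?_⟩
      rw [← hγ, ← Finset.sum_coe_sort]
      exact Finset.sum_congr rfl fun j _ => by simp [smul_eq_mul]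
    -- Koszul exchange: the part `∑ β j * m j` of `a k`, multiplied by `m k`, is absorbed into the
    -- coefficients over `K`.
    have h3 : t ∣ ∑ j ∈ K, (a j + β j * m k) * m j := by
      have : ∑ j ∈ K, (a j + β j * m k) * m j
          = (a k * m k + ∑ j ∈ K, a j * m j) - t * (b * m k) := by
        have : ∑ j ∈ K, (a j + β j * m k) * m j
          = ∑ j ∈ K, a j * m j + m k * ∑ j ∈ K, β j * m j := by
          rw [Finset.mul_sum, ← Finset.sum_add_distrib]
          exact Finset.sum_congr rfl fun j _ => by ring
        rw [this, hβ', hab]; ring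
      rw [this]
      exact dvd_sub ha (Dvd.intro _ rfl)
    obtain ⟨b', hb', hs⟩ := ih _ h3
    set f : ι → R := fun j => t * g j + m j with hf
    have hfm : ∀ j, f j ∈ Ideal.span (Set.range f) := fun j => Ideal.subset_span ⟨j, rfl⟩
    refine ⟨b' + g k * ∑ j ∈ K, β j * f j + f k * (b - ∑ j ∈ K, β j * g j), ?_, ?_⟩
    · refine Ideal.add_mem _ (Ideal.add_mem _ hb' (Ideal.mul_mem_left _ _ ?_))
        (Ideal.mul_mem_right _ _ (hfm k))
      exact Ideal.sum_mem _ fun j _ => Ideal.mul_mem_left _ _ (hfm j)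
    · have e1 : ∑ j ∈ K, (a j + β j * m k) * f j
          = ∑ j ∈ K, a j * f j + m k * ∑ j ∈ K, β j * f j := by
        rw [Finset.mul_sum, ← Finset.sum_add_distrib]
        exact Finset.sum_congr rfl fun j _ => by ring
      have e2 : ∑ j ∈ K, β j * f j = t * ∑ j ∈ K, β j * g j + z := by
        rw [← hβ', Finset.mul_sum, ← Finset.sum_add_distrib]
        exact Finset.sum_congr rfl fun j _ => by simp only [hf]; ring
      have e3 : f k = t * g k + m k := rfl
      have e4 : ∑ j ∈ K, a j * f j = t * b' - m k * ∑ j ∈ K, β j * f j := by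
        rw [← hs, e1]; ring
      change a k * f k + ∑ j ∈ K, a j * f j = _
      rw [e4, hab, e2, e3]
      ring

open MvPolynomial

variable {σ ι : Type*}

/-- Pairwise coprime monomials that do not involve the variable `τ`. -/
structure CoprimeExponents (τ : σ) (E : ι → σ →₀ ℕ) : Prop where
  apply_eq_zero : ∀ j, E j τ = 0
  disjoint : ∀ i j, i ≠ j → ∀ s, E i s = 0 ∨ E j s = 0

/-- `E k` shares no variable with `τ` or with the other `E j`, so a generator dividing a monomial
times `E k` already divides that monomial. -/
theorem CoprimeExponents.mem_span_of_mul_mem {τ : σ} {E : ι → σ →₀ ℕ}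
    (hE : CoprimeExponents τ E) (K : Finset ι) (k : ι) (hk : k ∉ K) (a : MvPolynomial σ ℂ)
    (h : a * monomial (E k) 1 ∈
      Ideal.span (insert (X τ) ((fun j => monomial (E j) (1 : ℂ)) '' (K : Set ι)))) :
    a ∈ Ideal.span (insert (X τ) ((fun j => monomial (E j) (1 : ℂ)) '' (K : Set ι))) := by
  classical
  have hset : (insert (X τ) ((fun j => monomial (E j) (1 : ℂ)) '' (K : Set ι)))
      = (fun s => monomial s (1 : ℂ)) '' (insert (Finsupp.single τ 1) (E '' (K : Set ι))) := by
    rw [Set.image_insert_eq, Set.image_image]; rfl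
  rw [hset, mem_ideal_span_monomial_image] at h ⊢
  intro e he
  have he' : e + E k ∈ (a * monomial (E k) 1).support := by
    rw [mem_support_iff, coeff_mul_monomial]
    simpa using he
  obtain ⟨d, hd, hle⟩ := h _ he'
  refine ⟨d, hd, fun s => ?_⟩
  have hs : d s ≤ e s + E k s := hle s
  rcases hd with rfl | ⟨j, hj, rfl⟩
  · by_cases hsτ : s = τ
    · subst hsτ; rwa [hE.apply_eq_zero k] at hs
    · rw [Finsupp.single_apply, if_neg (Ne.symm hsτ)]; exact Nat.zero_le _
  · have hjk : j ≠ k := fun h => hk (h ▸ hj)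
    rcases hE.disjoint j k hjk s with h0 | h0
    · rw [h0]; exact Nat.zero_le _
    · rwa [h0] at hs

/-- A polynomial none of whose monomials is divisible by one of the monomials `E j`. -/
def IsStandard (E : ι → σ →₀ ℕ) (f : MvPolynomial σ ℂ) : Prop :=
  ∀ e ∈ f.support, ∀ j, ¬ E j ≤ e

/-- Modulo `τ` the ideal becomes the monomial ideal of the `E j`, which contains no non-zero
standard polynomial. So a factor `τ` splits off, and the absence of `τ`-torsion allows the argument
to be repeated. -/
theorem CoprimeExponents.pow_dvd_of_isStandard [Fintype ι] {τ : σ} {E : ι → σ →₀ ℕ}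
    (hE : CoprimeExponents τ E) (g : ι → MvPolynomial σ ℂ) (N : ℕ) :
    ∀ s : MvPolynomial σ ℂ, IsStandard E s →
      (∃ h, s - X τ ^ N * h ∈ Ideal.span (Set.range fun j => X τ * g j + monomial (E j) 1)) →
      X τ ^ N ∣ s := by
  classical
  induction N with
  | zero => intro s _ _; simp
  | succ N ih =>
    rintro s hs ⟨h, hmem⟩
    set f : ι → MvPolynomial σ ℂ := fun j => X τ * g j + monomial (E j) 1 with hf
    obtain ⟨a, ha⟩ := (Submodule.mem_span_range_iff_exists_fun (MvPolynomial σ ℂ)).1 hmem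
    have ha' : ∑ j, a j * f j = s - X τ ^ (N + 1) * h := by simpa [smul_eq_mul] using ha
    have hsum : ∑ j, a j * f j
        = X τ * (∑ j, a j * g j) + ∑ j, a j * monomial (E j) (1 : ℂ) := by
      rw [Finset.mul_sum, ← Finset.sum_add_distrib]
      exact Finset.sum_congr rfl fun j _ => by simp only [hf]; ring
    have hdvd : X τ ∣ s := by
      have hin : s ∈ Ideal.span ((fun d => monomial d (1 : ℂ)) ''
          (insert (Finsupp.single τ 1) (Set.range E))) := by
        have : s = X τ * (X τ ^ N * h + ∑ j, a j * g j)
            + ∑ j, a j * monomial (E j) (1 : ℂ) := by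
          have : s = X τ ^ (N + 1) * h + ∑ j, a j * f j := by rw [ha']; ring
          rw [this, hsum]; ring
        rw [this]
        refine Ideal.add_mem _ (Ideal.mul_mem_right _ _ (Ideal.subset_span ?_))
          (Ideal.sum_mem _ fun j _ => Ideal.mul_mem_left _ _ (Ideal.subset_span ?_))
        · exact ⟨_, Set.mem_insert _ _, rfl⟩
        · exact ⟨_, Set.mem_insert_of_mem _ ⟨j, rfl⟩, rfl⟩
      rw [mem_ideal_span_monomial_image] at hin
      rw [s.as_sum]
      refine Finset.dvd_sum fun e he => ?_
      obtain ⟨d, hd, hle⟩ := hin e he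
      rcases hd with rfl | ⟨j, rfl⟩
      · rw [X_dvd_monomial]
        right
        have := hle τ
        rw [Finsupp.single_eq_same] at this
        omega
      · exact absurd hle (hs e he j)
    obtain ⟨s', rfl⟩ := hdvd
    have hs' : IsStandard E s' := by
      intro e he j hle
      refine hs (Finsupp.single τ 1 + e) ?_ j (hle.trans le_add_self)
      rw [mem_support_iff, coeff_X_mul]
      simpa using he
    have hdvd : X τ ∣ ∑ j ∈ Finset.univ, a j * monomial (E j) (1 : ℂ) := by
      refine ⟨s' - X τ ^ N * h - ∑ j, a j * g j, ?_⟩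
      have := hsum.symm.trans ha'
      linear_combination this
    obtain ⟨b, hb, hbe⟩ := Finset.sum_mul_add_mem_smul_span (X τ)
      (fun j => monomial (E j) (1 : ℂ)) g (fun K k hk a => hE.mem_span_of_mul_mem K k hk a)
      Finset.univ a hdvd
    rw [pow_succ']
    refine mul_dvd_mul_left _ (ih s' hs' ⟨h, ?_⟩)
    have : s' - X τ ^ N * h = b := by
      refine mul_left_cancel₀ (X_ne_zero τ) ?_
      rw [← hbe]; rw [ha']; ring
    rwa [this]

/-- Rewriting `E j` into `-τ g j` makes the part of a polynomial that is not standard divisible by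
any power of `τ`. -/
theorem exists_isStandard_sub_mem {τ : σ} {E : ι → σ →₀ ℕ} (g : ι → MvPolynomial σ ℂ)
    (U : Set (σ →₀ ℕ))
    (hU : ∀ j ν, E j + ν ∈ U → ∀ e ∈ (X τ * g j).support, e + ν ∈ U)
    (hEτ : ∀ j, E j τ = 0) (N : ℕ) :
    ∀ p ∈ restrictSupport ℂ U, ∃ s ∈ restrictSupport ℂ U, IsStandard E s ∧
      ∃ h, X τ ^ N * h ∈ restrictSupport ℂ U ∧
        p - s - X τ ^ N * h ∈ Ideal.span (Set.range fun j => X τ * g j + monomial (E j) 1) := by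
  classical
  have hstd_add : ∀ a b, IsStandard E a → IsStandard E b → IsStandard E (a + b) := by
    intro a b ha hb e he
    rcases Finset.mem_union.1 (support_add he) with h | h
    exacts [ha e h, hb e h]
  have hXN : ∀ N : ℕ, (X τ : MvPolynomial σ ℂ) ^ N = monomial (Finsupp.single τ N) 1 :=
    fun N => X_pow_eq_monomial
  induction N with
  | zero =>
    intro p hp
    exact ⟨0, Submodule.zero_mem _, by intro e he; simp at he, p, by simpa using hp, by simp⟩
  | succ N ih =>
    intro p hp
    obtain ⟨s, hsU, hs, h, hhU, hmem⟩ := ih p hp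
    have key : ∀ e ∈ h.support, ∃ s' ∈ restrictSupport ℂ U, IsStandard E s' ∧
        ∃ h', X τ ^ (N + 1) * h' ∈ restrictSupport ℂ U ∧
          X τ ^ N * monomial e (coeff e h) - s' - X τ ^ (N + 1) * h' ∈
            Ideal.span (Set.range fun j => X τ * g j + monomial (E j) 1) := by
      intro e he
      have heU : Finsupp.single τ N + e ∈ U := by
        refine (mem_restrictSupport_iff ℂ).1 hhU ?_
        rw [Finset.mem_coe, mem_support_iff, hXN, coeff_monomial_mul, one_mul]
        exact mem_support_iff.1 he
      by_cases hst : ∀ j, ¬ E j ≤ Finsupp.single τ N + e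
      · refine ⟨X τ ^ N * monomial e (coeff e h), ?_, ?_, 0, by simp, by simp⟩
        · rw [hXN, monomial_mul]
          exact (monomial_mem_restrictSupport ℂ).2 (Or.inl heU)
        · intro e' he'
          rw [hXN, monomial_mul] at he'
          have := Finset.mem_singleton.1 (support_monomial_subset he')
          rw [this]; exact hst
      · push Not at hst
        obtain ⟨j, hj⟩ := hst
        have hje : E j ≤ e := by
          intro i
          by_cases hi : i = τ
          · rw [hi, hEτ]; exact Nat.zero_le _
          · have := hj i
            rwa [Finsupp.add_apply, Finsupp.single_apply, if_neg (Ne.symm hi), zero_add] at this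
        obtain ⟨ν, rfl⟩ := exists_add_of_le hje
        -- One rewriting step raises the power of `τ` by one, and `hU` keeps the result supported in
        -- `U`.
        refine ⟨0, Submodule.zero_mem _, by intro e he; simp at he,
          -(g j * monomial ν (coeff (E j + ν) h)), ?_, ?_⟩
        · rw [mul_neg]
          refine Submodule.neg_mem _ ((mem_restrictSupport_iff ℂ).2 fun e' he' => ?_)
          have e1 : X τ ^ (N + 1) * (g j * monomial ν (coeff (E j + ν) h))
              = (X τ * g j) * monomial (Finsupp.single τ N + ν) (coeff (E j + ν) h) := by
            rw [← one_mul (coeff (E j + ν) h), ← monomial_mul, ← hXN, one_mul]; ring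
          rw [e1, Finset.mem_coe] at he'
          obtain ⟨d, hd, d', hd', rfl⟩ := Finset.mem_add.1 (support_mul _ _ he')
          rw [Finset.mem_singleton.1 (support_monomial_subset hd')]
          refine hU j _ ?_ d hd
          rwa [add_left_comm]
        · have : X τ ^ N * monomial (E j + ν) (coeff (E j + ν) h) - 0
              - X τ ^ (N + 1) * -(g j * monomial ν (coeff (E j + ν) h))
              = (X τ ^ N * monomial ν (coeff (E j + ν) h)) *
                (X τ * g j + monomial (E j) 1) := by
            have : monomial (E j + ν) (coeff (E j + ν) h)
                = monomial (E j) 1 * monomial ν (coeff (E j + ν) h) := by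
              rw [monomial_mul, one_mul]
            rw [this]; ring
          rw [this]
          exact Ideal.mul_mem_left _ _ (Ideal.subset_span ⟨j, rfl⟩)
    choose! s' hs'U hs' h' hh'U hmem' using key
    refine ⟨s + ∑ e ∈ h.support, s' e, Submodule.add_mem _ hsU (Submodule.sum_mem _ hs'U), ?_,
      ∑ e ∈ h.support, h' e, ?_, ?_⟩
    · refine hstd_add _ _ hs ?_
      exact Finset.sum_induction _ (IsStandard E) hstd_add (by intro e he; simp at he) hs'
    · rw [Finset.mul_sum]; exact Submodule.sum_mem _ hh'U
    · have e1 : p - (s + ∑ e ∈ h.support, s' e) - X τ ^ (N + 1) * ∑ e ∈ h.support, h' e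
          = (p - s - X τ ^ N * h) + ∑ e ∈ h.support,
            (X τ ^ N * monomial e (coeff e h) - s' e - X τ ^ (N + 1) * h' e) := by
        rw [Finset.sum_sub_distrib, Finset.sum_sub_distrib, ← Finset.mul_sum, ← Finset.mul_sum,
          ← h.as_sum]
        ring
      rw [e1]
      exact Ideal.add_mem _ hmem (Ideal.sum_mem _ hmem')

/-- The order need not be a well-order, so ordinary division might not terminate; rewriting is cut
off at a high power of `τ`. If `e₀` were standard, the lead term plus the standard remainder of the
smaller terms would be divisible by that power, although its coefficient at `e₀` is non-zero. -/
theorem CoprimeExponents.exists_le_of_isLead [Fintype ι] {τ : σ} {E : ι → σ →₀ ℕ}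
    (hE : CoprimeExponents τ E) (g : ι → MvPolynomial σ ℂ)
    {lt : (σ →₀ ℕ) → (σ →₀ ℕ) → Prop} (hlt : IsMonomialOrdering lt)
    (hg : ∀ j, ∀ e ∈ (X τ * g j).support, lt e (E j)) {f : MvPolynomial σ ℂ}
    (hf : f ∈ Ideal.span (Set.range fun j => X τ * g j + monomial (E j) (1 : ℂ)))
    {e₀ : σ →₀ ℕ} (he₀ : e₀ ∈ f.support) (hlead : ∀ e ∈ f.support, e ≠ e₀ → lt e e₀) :
    ∃ j, E j ≤ e₀ := by
  classical
  by_contra! hst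
  set U : Set (σ →₀ ℕ) := {e | lt e e₀} with hUdef
  have he₀U : e₀ ∉ U := hlt.irrefl e₀
  have hp : f - monomial e₀ (coeff e₀ f) ∈ restrictSupport ℂ U := by
    refine (mem_restrictSupport_iff ℂ).2 fun e he => ?_
    rw [Finset.mem_coe, mem_support_iff, coeff_sub, coeff_monomial] at he
    by_cases h : e₀ = e
    · subst h; simp at he
    · rw [if_neg h, sub_zero] at he
      exact hlead e (mem_support_iff.2 he) (Ne.symm h)
  -- Rewriting only produces exponents below `e₀`, so it cannot cancel the lead term. The cutoff `e₀
  -- τ + 1` is the first power of `τ` that does not divide the monomial `e₀`.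
  obtain ⟨s, hsU, hs, h, -, hmem⟩ := exists_isStandard_sub_mem g U
    (fun j ν hν e he => hlt.trans _ _ _ (hlt.add_right _ _ ν (hg j e he)) hν)
    hE.apply_eq_zero (e₀ τ + 1) _ hp
  have hs₀ : coeff e₀ s = 0 := by
    by_contra hne
    exact he₀U ((mem_restrictSupport_iff ℂ).1 hsU (mem_support_iff.2 hne))
  have hdvd : X τ ^ (e₀ τ + 1) ∣ monomial e₀ (coeff e₀ f) + s := by
    refine hE.pow_dvd_of_isStandard g _ _ ?_ ⟨-h, ?_⟩
    · intro e he
      rcases Finset.mem_union.1 (support_add he) with h | h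
      · rw [Finset.mem_singleton.1 (support_monomial_subset h)]; exact hst
      · exact hs e h
    · have := Ideal.sub_mem _ hf hmem
      convert this using 1
      ring
  obtain ⟨q, hq⟩ := hdvd
  have h1 := congrArg (coeff e₀) hq
  rw [coeff_add, coeff_monomial, if_pos rfl, hs₀, add_zero, X_pow_eq_monomial,
    coeff_monomial_mul', if_neg] at h1
  · exact mem_support_iff.1 he₀ h1
  · intro hle
    have := hle τ
    rw [Finsupp.single_eq_same] at this
    omega

theorem weightOrdering_isMonomialOrdering {lt : (σ →₀ ℕ) → (σ →₀ ℕ) → Prop}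
    (hlt : IsMonomialOrdering lt) (w : σ → ℝ) : IsMonomialOrdering (weightOrdering w lt) := by
  have hadd : ∀ a c : σ →₀ ℕ, ((a + c).sum fun i k => (k : ℝ) * w i)
      = (a.sum fun i k => (k : ℝ) * w i) + c.sum fun i k => (k : ℝ) * w i := fun a c =>
    Finsupp.sum_add_index' (by simp) (by intros; push_cast; ring)
  refine ⟨?_, ?_, ?_, ?_⟩
  · rintro a (h | ⟨-, h⟩)
    exacts [lt_irrefl _ h, hlt.irrefl _ h]
  · rintro a b c (h | ⟨h, h'⟩) (k | ⟨k, k'⟩)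
    · exact Or.inl (h.trans k)
    · exact Or.inl (k ▸ h)
    · exact Or.inl (h ▸ k)
    · exact Or.inr ⟨h.trans k, hlt.trans _ _ _ h' k'⟩
  · intro a b
    rcases lt_trichotomy (a.sum fun i k => (k : ℝ) * w i) (b.sum fun i k => (k : ℝ) * w i)
      with h | h | h
    · exact Or.inl (Or.inl h)
    · rcases hlt.total a b with k | k | k
      · exact Or.inl (Or.inr ⟨h, k⟩)
      · exact Or.inr (Or.inl k)
      · exact Or.inr (Or.inr (Or.inr ⟨h.symm, k⟩))
    · exact Or.inr (Or.inr (Or.inl h))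
  · rintro a b c (h | ⟨h, h'⟩)
    · left; rw [hadd, hadd]; linarith
    · right; rw [hadd, hadd]; exact ⟨by rw [h], hlt.add_right _ _ _ h'⟩

theorem IsMonomialOrdering.exists_lead {lt : (σ →₀ ℕ) → (σ →₀ ℕ) → Prop}
    (hlt : IsMonomialOrdering lt) (s : Finset (σ →₀ ℕ)) (hs : s.Nonempty) :
    ∃ e ∈ s, ∀ e' ∈ s, e' ≠ e → lt e' e := by
  classical
  induction hs using Finset.Nonempty.cons_induction with
  | singleton a => exact ⟨a, by simp, by simp⟩
  | cons a s ha hs ih =>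
    obtain ⟨e, he, hmax⟩ := ih
    simp only [Finset.mem_cons]
    rcases hlt.total a e with h | h | h
    · exact ⟨e, Or.inr he, by rintro e' (rfl | h') hne; exacts [h, hmax e' h' hne]⟩
    · exact absurd (h ▸ he) ha
    · refine ⟨a, Or.inl rfl, ?_⟩
      rintro e' (rfl | h') hne
      · exact absurd rfl hne
      · by_cases hee : e' = e
        · rw [hee]; exact h
        · exact hlt.trans _ _ _ (hmax e' h' hee) h

theorem CoprimeExponents.support_eq {τ : σ} {E : ι → σ →₀ ℕ} (hE : CoprimeExponents τ E)
    (g : ι → MvPolynomial σ ℂ) (j : ι) (e : σ →₀ ℕ) :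
    e ∈ (X τ * g j + monomial (E j) (1 : ℂ)).support ↔
      e ∈ (X τ * g j).support ∨ e = E j := by
  classical
  have h0 : coeff (E j) (X τ * g j) = 0 := by
    rw [coeff_X_mul', if_neg]
    rw [Finsupp.mem_support_iff, not_not]; exact hE.apply_eq_zero j
  rw [mem_support_iff, coeff_add, coeff_monomial, mem_support_iff]
  by_cases h : E j = e
  · subst h; simp [h0]
  · simp [h, Ne.symm h]

theorem CoprimeExponents.leadIdeal_eq [Fintype ι] {τ : σ} {E : ι → σ →₀ ℕ}
    (hE : CoprimeExponents τ E) (g : ι → MvPolynomial σ ℂ)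
    {lt : (σ →₀ ℕ) → (σ →₀ ℕ) → Prop} (hlt : IsMonomialOrdering lt)
    (hg : ∀ j, ∀ e ∈ (X τ * g j).support, lt e (E j)) :
    leadIdeal lt (Ideal.span (Set.range fun j => X τ * g j + monomial (E j) (1 : ℂ)))
      = Ideal.span (Set.range fun j => monomial (E j) (1 : ℂ)) := by
  refine le_antisymm (Ideal.span_le.2 ?_) (Ideal.span_le.2 ?_)
  · rintro p ⟨f, hf, e, he, hlead, rfl⟩
    obtain ⟨j, hj⟩ := hE.exists_le_of_isLead g hlt hg hf he hlead
    obtain ⟨ν, rfl⟩ := exists_add_of_le hj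
    have : monomial (E j + ν) (1 : ℂ) = monomial ν 1 * monomial (E j) 1 := by
      rw [monomial_mul, one_mul, add_comm]
    rw [this]
    exact Ideal.mul_mem_left _ _ (Ideal.subset_span ⟨j, rfl⟩)
  · rintro p ⟨j, rfl⟩
    refine Ideal.subset_span ⟨_, Ideal.subset_span ⟨j, rfl⟩, E j,
      (hE.support_eq g j _).2 (Or.inr rfl), fun e he hne => ?_, rfl⟩
    exact hg j e (((hE.support_eq g j e).1 he).resolve_right hne)

/-- The lead monomial of the generator is divisible by some `E i`; the terms of `X τ * g j` are
standard, so only `E j` can lead. This converts an equality of lead ideals into inequalities. -/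
theorem CoprimeExponents.lt_of_leadIdeal_eq {τ : σ} {E : ι → σ →₀ ℕ}
    (hE : CoprimeExponents τ E) (g : ι → MvPolynomial σ ℂ)
    {lt : (σ →₀ ℕ) → (σ →₀ ℕ) → Prop} (hlt : IsMonomialOrdering lt)
    (hstd : ∀ j, IsStandard E (X τ * g j))
    (h : leadIdeal lt (Ideal.span (Set.range fun j => X τ * g j + monomial (E j) (1 : ℂ)))
      = Ideal.span (Set.range fun j => monomial (E j) (1 : ℂ))) (j : ι) :
    ∀ e ∈ (X τ * g j).support, lt e (E j) := by
  classical
  intro e he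
  obtain ⟨e₀, he₀, hlead⟩ := hlt.exists_lead (X τ * g j + monomial (E j) (1 : ℂ)).support
    ⟨E j, (hE.support_eq g j _).2 (Or.inr rfl)⟩
  have hmem : monomial e₀ (1 : ℂ) ∈ Ideal.span (Set.range fun j => monomial (E j) (1 : ℂ)) := by
    rw [← h]
    exact Ideal.subset_span ⟨_, Ideal.subset_span ⟨j, rfl⟩, e₀, he₀, hlead, rfl⟩
  have hr : (Set.range fun j => monomial (E j) (1 : ℂ))
      = (fun s => monomial s (1 : ℂ)) '' Set.range E := by
    rw [← Set.range_comp]; rfl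
  rw [hr, mem_ideal_span_monomial_image] at hmem
  obtain ⟨_, ⟨i, rfl⟩, hi⟩ := hmem e₀ (by rw [mem_support_iff, coeff_monomial]; simp)
  rcases (hE.support_eq g j _).1 he₀ with h1 | rfl
  · exact absurd hi (hstd j e₀ h1 i)
  · refine hlead e ((hE.support_eq g j _).2 (Or.inl he)) ?_
    rintro rfl
    exact hstd j _ he j le_rfl

end Groebner

/-! ### Fixed points over the field of Hahn series. -/

section Hahn

namespace HahnSeries

variable {K : Type*} [Field K]

theorem le_orderTop_add {δ : WithTop ℝ} {x y : HahnSeries ℝ K} (hx : δ ≤ x.orderTop)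
    (hy : δ ≤ y.orderTop) : δ ≤ (x + y).orderTop :=
  (le_min hx hy).trans min_orderTop_le_orderTop_add

theorem le_orderTop_sub {δ : WithTop ℝ} {x y : HahnSeries ℝ K} (hx : δ ≤ x.orderTop)
    (hy : δ ≤ y.orderTop) : δ ≤ (x - y).orderTop :=
  (le_min hx hy).trans min_orderTop_le_orderTop_sub

theorem le_orderTop_mul {δ δ' : WithTop ℝ} {x y : HahnSeries ℝ K} (hx : δ ≤ x.orderTop)
    (hy : δ' ≤ y.orderTop) : δ + δ' ≤ (x * y).orderTop := by
  rw [orderTop_mul]; exact add_le_add hx hy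

theorem le_orderTop_sum {ι : Type*} {δ : WithTop ℝ} (s : Finset ι) (f : ι → HahnSeries ℝ K)
    (h : ∀ i ∈ s, δ ≤ (f i).orderTop) : δ ≤ (∑ i ∈ s, f i).orderTop :=
  Finset.sum_induction f (fun x => δ ≤ x.orderTop) (fun _ _ => le_orderTop_add) (by simp) h

/-- The pairs of series of non-negative order that agree up to order `δ`. -/
def congrSubmonoid (K : Type*) [Field K] (δ : WithTop ℝ) :
    Submonoid (HahnSeries ℝ K × HahnSeries ℝ K) where
  carrier := {z | 0 ≤ z.1.orderTop ∧ 0 ≤ z.2.orderTop ∧ δ ≤ (z.1 - z.2).orderTop}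
  one_mem' := by simp
  mul_mem' := by
    rintro ⟨a, b⟩ ⟨c, d⟩ ⟨ha, hb, hab⟩ ⟨hc, hd, hcd⟩
    refine ⟨by simpa using le_orderTop_mul ha hc, by simpa using le_orderTop_mul hb hd, ?_⟩
    have : (a, b).1 * (c, d).1 - (a, b).2 * (c, d).2 = (a - b) * c + b * (c - d) := by
      simp only; ring
    change δ ≤ ((a, b).1 * (c, d).1 - (a, b).2 * (c, d).2).orderTop
    rw [this]
    refine le_orderTop_add ?_ ?_
    · simpa using le_orderTop_mul hab hc
    · simpa using le_orderTop_mul hb hcd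

/-- Substitution into monomials preserves agreement up to order `δ` on series of non-negative order,
and the coefficients contribute a further `ε`. For `ε > 0` this is the contraction estimate. -/
theorem le_orderTop_eval_sub {κ : Type*} {ε δ : WithTop ℝ}
    (p : MvPolynomial κ (HahnSeries ℝ K)) (hp : ∀ e, ε ≤ (p.coeff e).orderTop)
    {x y : κ → HahnSeries ℝ K} (hx : ∀ i, 0 ≤ (x i).orderTop) (hy : ∀ i, 0 ≤ (y i).orderTop)
    (hxy : ∀ i, δ ≤ (x i - y i).orderTop) :
    ε + δ ≤ (MvPolynomial.eval x p - MvPolynomial.eval y p).orderTop := by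
  rw [MvPolynomial.eval_eq, MvPolynomial.eval_eq, ← Finset.sum_sub_distrib]
  refine le_orderTop_sum _ _ fun e _ => ?_
  rw [← mul_sub]
  refine le_orderTop_mul (hp e) ?_
  have : ∏ i ∈ e.support, ((x i, y i) : HahnSeries ℝ K × HahnSeries ℝ K) ^ e i
      ∈ congrSubmonoid K δ :=
    Submonoid.prod_mem _ fun i _ => Submonoid.pow_mem _
      (show (x i, y i) ∈ congrSubmonoid K δ from ⟨hx i, hy i, hxy i⟩) _
  have h3 := this.2.2
  rwa [Prod.fst_prod, Prod.snd_prod] at h3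

theorem le_orderTop_eval {κ : Type*} {ε : WithTop ℝ}
    (p : MvPolynomial κ (HahnSeries ℝ K)) (hp : ∀ e, ε ≤ (p.coeff e).orderTop)
    {x : κ → HahnSeries ℝ K} (hx : ∀ i, 0 ≤ (x i).orderTop) :
    ε ≤ (MvPolynomial.eval x p).orderTop := by
  rw [MvPolynomial.eval_eq]
  refine le_orderTop_sum _ _ fun e _ => ?_
  have : ∏ i ∈ e.support, ((x i, x i) : HahnSeries ℝ K × HahnSeries ℝ K) ^ e i
      ∈ congrSubmonoid K 0 :=
    Submonoid.prod_mem _ fun i _ => Submonoid.pow_mem _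
      (show (x i, x i) ∈ congrSubmonoid K 0 from ⟨hx i, hx i, by simp⟩) _
  have h3 := this.1
  rw [Prod.fst_prod] at h3
  simpa using le_orderTop_mul (hp e) h3

theorem coeff_eq_of_le_orderTop_sub {x y : HahnSeries ℝ K} {δ g : ℝ}
    (h : (δ : WithTop ℝ) ≤ (x - y).orderTop) (hg : g < δ) : x.coeff g = y.coeff g := by
  have := coeff_eq_zero_of_lt_orderTop (lt_of_lt_of_le (WithTop.coe_lt_coe.2 hg) h)
  rwa [coeff_sub, sub_eq_zero] at this

/-- The coefficient at an exponent `g` is constant once `g < k * ε`, which gives a coefficientwise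
limit. -/
theorem exists_limit {ε : ℝ} (hε : 0 < ε) (f : ℕ → HahnSeries ℝ K)
    (hf : ∀ k : ℕ, ((k * ε : ℝ) : WithTop ℝ) ≤ (f (k + 1) - f k).orderTop) :
    ∃ x : HahnSeries ℝ K, ∀ k : ℕ, ((k * ε : ℝ) : WithTop ℝ) ≤ (x - f k).orderTop := by
  have hstep : ∀ (k l : ℕ) (g : ℝ), k ≤ l → g < k * ε → (f l).coeff g = (f k).coeff g := by
    intro k l g hkl hg
    induction l, hkl using Nat.le_induction with
    | base => rfl
    | succ l hl ih =>
      rw [← ih]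
      refine coeff_eq_of_le_orderTop_sub (hf l) (hg.trans_le ?_)
      exact mul_le_mul_of_nonneg_right (by exact_mod_cast hl) hε.le
  have hex : ∀ g : ℝ, ∃ k : ℕ, g < k * ε := fun g => by
    obtain ⟨k, hk⟩ := exists_nat_gt (g / ε)
    exact ⟨k, by rwa [div_lt_iff₀ hε] at hk⟩
  choose κ hκ using hex
  have hcoeff : ∀ (k : ℕ) (g : ℝ), g < k * ε → (f (κ g)).coeff g = (f k).coeff g := by
    intro k g hg
    rcases le_total k (κ g) with h | h
    · exact hstep _ _ _ h hg
    · exact (hstep _ _ _ h (hκ g)).symm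
  refine ⟨⟨fun g => (f (κ g)).coeff g, ?_⟩, fun k => ?_⟩
  · rw [Set.isPWO_iff_isWF, Set.isWF_iff_no_descending_seq]
    -- A descending sequence stays below its first term, where the limit agrees with a single `f k`,
    -- whose support is well-ordered.
    intro u hu hmem
    refine (Set.isWF_iff_no_descending_seq.1 (f (κ (u 0))).isWF_support) u hu fun n => ?_
    have h1 := hmem n
    have h2 : u n < κ (u 0) * ε := (hu.antitone (Nat.zero_le n)).trans_lt (hκ (u 0))
    rw [Function.mem_support] at h1
    rw [mem_support, ← hcoeff _ _ h2]
    exact h1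
  · rw [le_orderTop_iff_forall]
    intro g hg
    rw [coeff_sub, sub_eq_zero]
    exact hcoeff k g (WithTop.coe_lt_coe.1 hg)

theorem eq_of_forall_le_orderTop_sub {ε : ℝ} (hε : 0 < ε) {x y : HahnSeries ℝ K}
    (h : ∀ k : ℕ, ((k * ε : ℝ) : WithTop ℝ) ≤ (x - y).orderTop) : x = y := by
  ext g
  obtain ⟨k, hk⟩ := exists_nat_gt (g / ε)
  exact coeff_eq_of_le_orderTop_sub (h k) (by rwa [div_lt_iff₀ hε] at hk)

/-- A polynomial system that perturbs constants by terms of positive order has a solution. -/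
theorem exists_fixedPoint {κ : Type*} [Finite κ] (α : κ → K)
    (p : κ → MvPolynomial κ (HahnSeries ℝ K)) (hp : ∀ i e, 0 < ((p i).coeff e).orderTop) :
    ∃ l : κ → HahnSeries ℝ K, ∀ i, l i = C (α i) + MvPolynomial.eval l (p i) ∧
      0 < (l i - C (α i)).orderTop := by
  -- Only finitely many non-zero coefficients occur, so their positive orders have a common positive
  -- lower bound.
  obtain ⟨ε, hε, hpε⟩ : ∃ ε : ℝ, 0 < ε ∧ ∀ i e, (ε : WithTop ℝ) ≤ ((p i).coeff e).orderTop := by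
    have hfin : (⋃ i, (fun e => ((p i).coeff e)) '' ((p i).support : Set (κ →₀ ℕ))).Finite :=
      Set.finite_iUnion fun i => (p i).support.finite_toSet.image _
    have hpos : ∀ z ∈ ⋃ i, (fun e => ((p i).coeff e)) '' ((p i).support : Set (κ →₀ ℕ)),
        0 < z.order := by
      rintro z hz
      obtain ⟨i, e, he, rfl⟩ := Set.mem_iUnion.1 hz
      exact (zero_lt_orderTop_iff (MvPolynomial.mem_support_iff.1 he)).1 (hp i e)
    have : ∃ ε : ℝ, 0 < ε ∧
        ∀ z ∈ ⋃ i, (fun e => ((p i).coeff e)) '' ((p i).support : Set (κ →₀ ℕ)), ε ≤ z.order := by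
      generalize (⋃ i, (fun e => ((p i).coeff e)) '' ((p i).support : Set (κ →₀ ℕ))) = S
        at hfin hpos
      induction S, hfin using Set.Finite.induction_on with
      | empty => exact ⟨1, one_pos, by simp⟩
      | @insert a S _ _ ih =>
        obtain ⟨ε, h1, h2⟩ := ih fun z hz => hpos z (Or.inr hz)
        refine ⟨min ε a.order, lt_min h1 (hpos a (Or.inl rfl)), ?_⟩
        rintro z (rfl | hz)
        · exact min_le_right _ _
        · exact (min_le_left _ _).trans (h2 z hz)
    obtain ⟨ε, h1, h2⟩ := this
    refine ⟨ε, h1, fun i e => ?_⟩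
    by_cases h : (p i).coeff e = 0
    · simp [h]
    · rw [← order_eq_orderTop_of_ne_zero h]
      exact WithTop.coe_le_coe.2
        (h2 _ (Set.mem_iUnion.2 ⟨i, e, MvPolynomial.mem_support_iff.2 h, rfl⟩))
  have hε0 : (0 : WithTop ℝ) ≤ (ε : WithTop ℝ) := by exact_mod_cast hε.le
  have hα : ∀ i, (0 : WithTop ℝ) ≤ (C (Γ := ℝ) (α i)).orderTop := fun i => by
    rw [C_apply]; exact orderTop_single_le
  let Φ : (κ → HahnSeries ℝ K) → κ → HahnSeries ℝ K :=
    fun l i => C (α i) + MvPolynomial.eval l (p i)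
  have hΦ0 : ∀ l : κ → HahnSeries ℝ K, (∀ i, 0 ≤ (l i).orderTop) → ∀ i, 0 ≤ (Φ l i).orderTop :=
    fun l hl i => le_orderTop_add (hα i) (hε0.trans (le_orderTop_eval _ (hpε i) hl))
  have hΦ : ∀ (δ : ℝ) (l l' : κ → HahnSeries ℝ K), (∀ i, 0 ≤ (l i).orderTop) →
      (∀ i, 0 ≤ (l' i).orderTop) → (∀ i, (δ : WithTop ℝ) ≤ (l i - l' i).orderTop) →
      ∀ i, ((ε + δ : ℝ) : WithTop ℝ) ≤ (Φ l i - Φ l' i).orderTop := by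
    intro δ l l' hl hl' h i
    have : Φ l i - Φ l' i = MvPolynomial.eval l (p i) - MvPolynomial.eval l' (p i) := by
      simp only [Φ]; ring
    rw [this, WithTop.coe_add]
    exact le_orderTop_eval_sub _ (hpε i) hl hl' h
  -- Each iteration of `Φ` from zero gains `ε` in the order of the difference of successive terms.
  let f : ℕ → κ → HahnSeries ℝ K := fun k => Φ^[k] (fun _ => 0)
  have hf : ∀ k, f (k + 1) = Φ (f k) := fun k => Function.iterate_succ_apply' Φ k _
  have hf0 : ∀ k i, 0 ≤ (f k i).orderTop := by
    intro k
    induction k with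
    | zero => intro i; simp [f]
    | succ k ih => rw [hf]; exact hΦ0 _ ih
  have hcauchy : ∀ (k : ℕ) i, ((k * ε : ℝ) : WithTop ℝ) ≤ (f (k + 1) i - f k i).orderTop := by
    intro k
    induction k with
    | zero =>
      intro i
      rw [Nat.cast_zero, zero_mul]
      exact le_orderTop_sub (hf0 1 i) (hf0 0 i)
    | succ k ih =>
      intro i
      have := hΦ _ _ _ (hf0 (k + 1)) (hf0 k) ih i
      rw [← hf, ← hf] at this
      refine le_trans (WithTop.coe_le_coe.2 (le_of_eq ?_)) this
      push_cast; ring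
  choose l hl using fun i => exists_limit hε (fun k => f k i) (fun k => hcauchy k i)
  have hl0 : ∀ i, 0 ≤ (l i).orderTop := by
    intro i
    have h1 := hl i 0
    rw [Nat.cast_zero, zero_mul] at h1
    simpa using le_orderTop_add h1 (hf0 0 i)
  have hfix : ∀ i, l i = Φ l i := by
    intro i
    refine eq_of_forall_le_orderTop_sub hε fun k => ?_
    have h1 := hl i (k + 1)
    have h2 := hΦ _ _ _ hl0 (hf0 k) (fun i => hl i k) i
    rw [← hf] at h2
    have hle1 : ((k * ε : ℝ) : WithTop ℝ) ≤ (((k + 1 : ℕ) * ε : ℝ) : WithTop ℝ) := by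
      rw [WithTop.coe_le_coe]; push_cast; linarith
    have hle2 : ((k * ε : ℝ) : WithTop ℝ) ≤ ((ε + k * ε : ℝ) : WithTop ℝ) := by
      rw [WithTop.coe_le_coe]; linarith
    have h3 := le_orderTop_sub (hle1.trans h1) (hle2.trans h2)
    simpa using h3
  refine ⟨l, fun i => ⟨hfix i, ?_⟩⟩
  have h1 : l i - C (α i) = MvPolynomial.eval l (p i) := by
    have := hfix i
    simp only [Φ] at this
    linear_combination this
  rw [h1]
  exact lt_of_lt_of_le (by exact_mod_cast hε) (le_orderTop_eval _ (hpε i) hl0)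

end HahnSeries

end Hahn

/-! ### Linear forms on polytopes. -/

theorem StrongDual.exists_eq_dotProduct {n : ℕ} (l : StrongDual ℝ (Fin n → ℝ)) :
    ∃ w : Fin n → ℝ, ∀ x, l x = x ⬝ᵥ w := by
  refine ⟨(dotProductEquiv ℝ (Fin n)).symm l.toLinearMap, fun x => ?_⟩
  have h := congrArg (fun f => f x) ((dotProductEquiv ℝ (Fin n)).apply_symm_apply l.toLinearMap)
  rw [dotProduct_comm]
  exact h.symm

theorem realVec_dotProduct {n : ℕ} (m v : Fin n → ℤ) :
    realVec m ⬝ᵥ realVec v = ((m ⬝ᵥ v : ℤ) : ℝ) := by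
  simp [realVec, dotProduct]

theorem realVec_injective {n : ℕ} : Function.Injective (realVec (n := n)) := by
  intro a b h
  funext i
  have := congrFun h i
  simpa [realVec] using this

theorem finite_of_isBounded_realVec {n : ℕ} {P : Set (Fin n → ℝ)} (hP : Bornology.IsBounded P) :
    {m : Fin n → ℤ | realVec m ∈ P}.Finite := by
  obtain ⟨B, hB⟩ := hP.exists_norm_le
  refine (Set.finite_Icc (fun _ : Fin n => -⌈B⌉) (fun _ => ⌈B⌉)).subset fun m hm => ?_
  have h : ∀ i, |(m i : ℝ)| ≤ ⌈B⌉ := fun i =>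
    ((norm_le_pi_norm (realVec m) i).trans (hB _ hm)).trans (Int.le_ceil B)
  constructor <;> intro i
  · have := (abs_le.1 (h i)).1
    exact_mod_cast this
  · have := (abs_le.1 (h i)).2
    exact_mod_cast this

theorem convex_setOf_le_dotProduct {n : ℕ} (b : ℝ) (w : Fin n → ℝ) :
    Convex ℝ {x : Fin n → ℝ | b ≤ x ⬝ᵥ w} :=
  convex_halfSpace_ge ⟨fun _ _ => add_dotProduct _ _ _, fun _ _ => smul_dotProduct _ _ _⟩ b

theorem convex_polarDual {n : ℕ} (P : Set (Fin n → ℝ)) : Convex ℝ (polarDual P) := by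
  have : polarDual P = ⋂ w ∈ P, {x | -1 ≤ x ⬝ᵥ w} := by ext; simp [polarDual]
  rw [this]
  exact convex_iInter₂ fun w _ => convex_setOf_le_dotProduct _ _

theorem continuous_dotProduct_right {n : ℕ} (w : Fin n → ℝ) :
    Continuous fun x : Fin n → ℝ => x ⬝ᵥ w := by
  unfold dotProduct
  fun_prop

/-- A face of the convex hull of a set, cut out by a linear form bounded below, is the convex hull
of the points of the set that it contains. -/
theorem mem_convexHull_face {n : ℕ} {S : Set (Fin n → ℝ)} {w x : Fin n → ℝ} {b : ℝ}
    (hS : ∀ y ∈ S, b ≤ y ⬝ᵥ w) (hx : x ∈ convexHull ℝ S) (hxw : x ⬝ᵥ w = b) :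
    x ∈ convexHull ℝ {y ∈ S | y ⬝ᵥ w = b} := by
  obtain ⟨ι, _, a, z, ha, ha1, hz, rfl⟩ := mem_convexHull_iff_exists_fintype.1 hx
  have hsum : ∑ i, a i * (z i ⬝ᵥ w - b) = 0 := by
    simp only [mul_sub, Finset.sum_sub_distrib, ← Finset.sum_mul, ha1, one_mul]
    rw [sub_eq_zero, ← hxw, sum_dotProduct]
    simp [smul_dotProduct]
  have hzero : ∀ i, a i * (z i ⬝ᵥ w - b) = 0 := fun i =>
    (Finset.sum_eq_zero_iff_of_nonneg fun i _ =>
      mul_nonneg (ha i) (sub_nonneg.2 (hS _ (hz i)))).1 hsum i (Finset.mem_univ i)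
  have hmem : ∀ i ∈ Finset.univ.filter (fun i => a i ≠ 0), z i ∈ {y ∈ S | y ⬝ᵥ w = b} := by
    intro i hi
    refine ⟨hz i, ?_⟩
    have := (mul_eq_zero.1 (hzero i)).resolve_left (Finset.mem_filter.1 hi).2
    linarith
  have e1 : ∑ i, a i • z i = ∑ i with a i ≠ 0, a i • z i :=
    (Finset.sum_filter_of_ne fun i _ h => by rintro h0; simp [h0] at h).symm
  have e2 : ∑ i with a i ≠ 0, a i = 1 := by
    rw [← ha1]; exact Finset.sum_filter_of_ne fun i _ h => h
  rw [e1]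
  exact (convex_convexHull ℝ _).sum_mem (fun i _ => ha i) e2
    fun i hi => subset_convexHull ℝ _ (hmem i hi)

/-- A non-empty convex set contains a point at which none of finitely many linear forms, bounded
below by `-1`, takes the value `-1` unless it does so on the whole set. -/
theorem Convex.exists_generic {n : ℕ} {F : Set (Fin n → ℝ)} (hF : Convex ℝ F)
    (hne : F.Nonempty) {S : Set (Fin n → ℝ)} (hS : S.Finite)
    (hSF : ∀ m ∈ S, ∀ w ∈ F, -1 ≤ m ⬝ᵥ w) :
    ∃ w₀ ∈ F, ∀ m ∈ S, m ⬝ᵥ w₀ = -1 → ∀ w ∈ F, m ⬝ᵥ w = -1 := by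
  induction S, hS using Set.Finite.induction_on with
  | empty => obtain ⟨w, hw⟩ := hne; exact ⟨w, hw, by simp⟩
  | @insert m S _ _ ih =>
    obtain ⟨w₀, hw₀, h⟩ := ih fun m' hm' => hSF m' (Or.inr hm')
    by_cases hm : ∀ w ∈ F, m ⬝ᵥ w = -1
    · refine ⟨w₀, hw₀, ?_⟩
      rintro m' (rfl | hm') h'
      exacts [hm, h m' hm' h']
    · push Not at hm
      obtain ⟨w₁, hw₁, hne₁⟩ := hm
      -- At a midpoint a form bounded below by `-1` takes the value `-1` only if it does so at both
      -- ends.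
      have hmid : (1 / 2 : ℝ) • w₀ + (1 / 2 : ℝ) • w₁ ∈ F :=
        hF hw₀ hw₁ (by norm_num) (by norm_num) (by norm_num)
      refine ⟨_, hmid, ?_⟩
      intro m' hm' h'
      have e : m' ⬝ᵥ ((1 / 2 : ℝ) • w₀ + (1 / 2 : ℝ) • w₁)
          = (1 / 2) * (m' ⬝ᵥ w₀) + (1 / 2) * (m' ⬝ᵥ w₁) := by
        simp [dotProduct_add, dotProduct_smul]
      rw [e] at h'
      have h0 := hSF m' hm' w₀ hw₀
      have h1 := hSF m' hm' w₁ hw₁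
      rcases hm' with rfl | hm'
      · exact absurd (by linarith) hne₁
      · exact h m' hm' (by linarith)

theorem IsLatticePolytope.isCompact {P : Set (Fin n → ℝ)} (h : IsLatticePolytope P) :
    IsCompact P := by
  obtain ⟨V, rfl⟩ := h
  exact (V.finite_toSet.image _).isCompact_convexHull ℝ

theorem IsLatticePolytope.convex {P : Set (Fin n → ℝ)} (h : IsLatticePolytope P) :
    Convex ℝ P := by
  obtain ⟨V, rfl⟩ := h
  exact convex_convexHull _ _

/-! ### The reflexive polytope and its normal fan. -/

namespace ReflexivePolytope

variable {n : ℕ} {Δ : ReflexivePolytope n}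

variable (Δ) in
theorem isCompact_carrier : IsCompact Δ.carrier := Δ.isLatticePolytope.isCompact

variable (Δ) in
theorem convex_carrier : Convex ℝ Δ.carrier := Δ.isLatticePolytope.convex

variable (Δ) in
theorem zero_mem_carrier : (0 : Fin n → ℝ) ∈ Δ.carrier := interior_subset Δ.zero_mem_interior

variable (Δ) in
/-- The generator of a ray, as a point of `N_ℝ`. -/
def rayVec (r : Δ.Ray) : Fin n → ℝ := realVec r.gen

theorem rayVec_injective : Function.Injective Δ.rayVec :=
  fun _ _ h => Subtype.ext (realVec_injective h)

theorem rayVec_mem_polarDual (r : Δ.Ray) : Δ.rayVec r ∈ polarDual Δ.carrier := r.2.1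

variable (Δ) in
-- Krein–Milman: the extreme points of the dual are lattice points, hence rays.
theorem polarDual_eq_convexHull : polarDual Δ.carrier = convexHull ℝ (Set.range Δ.rayVec) := by
  have hext : (polarDual Δ.carrier).extremePoints ℝ = Set.range Δ.rayVec := by
    ext v
    constructor
    · intro hv
      obtain ⟨V, hV⟩ := Δ.isLatticePolytope_dual
      have hv' := hv
      rw [hV] at hv'
      obtain ⟨u, _, rfl⟩ := extremePoints_convexHull_subset hv'
      exact ⟨⟨u, hv⟩, rfl⟩
    · rintro ⟨r, rfl⟩
      exact r.2
  have h := closure_convexHull_extremePoints (s := polarDual Δ.carrier)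
    Δ.isLatticePolytope_dual.isCompact (convex_polarDual _)
  rw [hext, ((Set.finite_range _).isCompact_convexHull ℝ).isClosed.closure_eq] at h
  exact h.symm

theorem exists_sum_of_mem_polarDual {v : Fin n → ℝ} (hv : v ∈ polarDual Δ.carrier) :
    ∃ a : Δ.Ray → ℝ, (∀ r, 0 ≤ a r) ∧ ∑ r, a r = 1 ∧ ∑ r, a r • Δ.rayVec r = v := by
  classical
  rw [polarDual_eq_convexHull] at hv
  have hr : Set.range Δ.rayVec = ((Finset.univ.image Δ.rayVec : Finset _) : Set (Fin n → ℝ)) := by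
    simp
  rw [hr, Finset.mem_convexHull'] at hv
  obtain ⟨a, ha, ha1, hav⟩ := hv
  rw [Finset.sum_image rayVec_injective.injOn] at ha1 hav
  exact ⟨fun r => a (Δ.rayVec r), fun r => ha _ (by simp), ha1, hav⟩

/-- Bipolar argument: a form separating a point from Δ can be scaled into Δ*, because 0 ∈ Δ, and Δ*
is the hull of the rays. -/
theorem mem_carrier_iff {m : Fin n → ℝ} :
    m ∈ Δ.carrier ↔ ∀ r, -1 ≤ m ⬝ᵥ Δ.rayVec r := by
  constructor
  · intro hm r
    rw [dotProduct_comm]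
    exact rayVec_mem_polarDual r m hm
  · intro hm
    by_contra hmem
    obtain ⟨l, u, hlm, hl⟩ :=
      geometric_hahn_banach_point_closed Δ.convex_carrier Δ.isCompact_carrier.isClosed hmem
    obtain ⟨w, hw⟩ := l.exists_eq_dotProduct
    simp only [hw] at hlm hl
    have hu : u < 0 := by simpa using hl 0 Δ.zero_mem_carrier
    have hdual : (-u)⁻¹ • w ∈ polarDual Δ.carrier := by
      intro b hb
      have h1 := hl b hb
      rw [smul_dotProduct, dotProduct_comm, smul_eq_mul, ← div_eq_inv_mul,
        le_div_iff₀ (by linarith)]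
      linarith
    have hsub : convexHull ℝ (Set.range Δ.rayVec) ⊆ {v | -1 ≤ v ⬝ᵥ m} :=
      convexHull_min (by rintro _ ⟨r, rfl⟩; simpa [dotProduct_comm] using hm r)
        (convex_setOf_le_dotProduct _ _)
    rw [polarDual_eq_convexHull] at hdual
    have h2 : -1 ≤ ((-u)⁻¹ • w) ⬝ᵥ m := hsub hdual
    rw [smul_dotProduct, dotProduct_comm, smul_eq_mul, ← div_eq_inv_mul,
      le_div_iff₀ (by linarith)] at h2
    linarith

/-- Every vector lies in the cone over some proper face of the dual polytope. -/
theorem exists_coneFace (w : Fin n → ℝ) :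
    ∃ a : Δ.Ray → ℝ, (∀ r, 0 ≤ a r) ∧ ∑ r, a r • Δ.rayVec r = w ∧
      ∃ F ∈ Δ.coneFaces, ∀ r, a r ≠ 0 → Δ.rayVec r ∈ F := by
  obtain ⟨m₀, hm₀, hmin⟩ := Δ.isCompact_carrier.exists_isMinOn ⟨0, Δ.zero_mem_carrier⟩
    (continuous_dotProduct_right w).continuousOn
  have hmin' : ∀ m ∈ Δ.carrier, m₀ ⬝ᵥ w ≤ m ⬝ᵥ w := fun m hm => hmin hm
  have h0dual : (0 : Fin n → ℝ) ∈ polarDual Δ.carrier := interior_subset Δ.zero_mem_interior_dual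
  by_cases hw : w = 0
  · refine ⟨0, by simp, by simp [hw], ∅, ⟨fun h => absurd h (by simp), fun h => ?_⟩, by simp⟩
    rw [← h] at h0dual
    exact h0dual
  · have hneg : m₀ ⬝ᵥ w < 0 := by
      -- Since 0 is interior, Δ contains a small negative multiple of `w`.
      have hcont : Filter.Tendsto (fun s : ℝ => s • (-w)) (nhds 0) (nhds 0) := by
        have : Continuous fun s : ℝ => s • (-w) := by fun_prop
        simpa using this.tendsto 0
      have hev := hcont (mem_interior_iff_mem_nhds.1 Δ.zero_mem_interior)
      obtain ⟨ε, hε, hball⟩ := Metric.mem_nhds_iff.1 hev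
      have hmem : (ε / 2) • (-w) ∈ Δ.carrier := hball (by
        rw [Metric.mem_ball, Real.dist_eq, sub_zero, abs_of_pos (by linarith)]; linarith)
      have h1 := hmin' _ hmem
      have h2 : 0 < w ⬝ᵥ w := by
        rcases (Finset.sum_nonneg fun i _ => mul_self_nonneg (w i)).lt_or_eq with h | h
        · exact h
        · exact absurd (dotProduct_self_eq_zero.1 h.symm) hw
      have h3 : ((ε / 2) • (-w)) ⬝ᵥ w = -(ε / 2 * (w ⬝ᵥ w)) := by
        rw [smul_dotProduct, neg_dotProduct, smul_eq_mul]; ring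
      have := mul_pos (half_pos hε) h2
      linarith
    set h := -(m₀ ⬝ᵥ w) with hh
    have hpos : 0 < h := by linarith
    -- Rescaled to have minimum `-1` over Δ, `w` lies in the face of Δ* cut out by the minimiser
    -- `m₀`; every ray used in a convex combination must lie in that face too.
    have hdual : h⁻¹ • w ∈ polarDual Δ.carrier := by
      intro m hm
      have h1 := hmin' m hm
      rw [smul_dotProduct, dotProduct_comm, smul_eq_mul, ← div_eq_inv_mul, le_div_iff₀ hpos]
      linarith
    obtain ⟨a, ha, ha1, haw⟩ := exists_sum_of_mem_polarDual hdual
    refine ⟨fun r => h * a r, fun r => mul_nonneg hpos.le (ha r), ?_,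
      {v ∈ polarDual Δ.carrier | m₀ ⬝ᵥ v = -1}, ⟨?_, ?_⟩, ?_⟩
    · simp only [mul_smul]
      rw [← Finset.smul_sum, haw, smul_smul, mul_inv_cancel₀ hpos.ne', one_smul]
    · rintro ⟨v₀, hv₀, hv₀m⟩
      refine ⟨LinearMap.toContinuousLinearMap (-(dotProductEquiv ℝ (Fin n) m₀)), ?_⟩
      ext v
      simp only [Set.mem_ofPred, LinearMap.coe_toContinuousLinearMap', LinearMap.neg_apply,
        dotProductEquiv_apply_apply, neg_le_neg_iff]
      refine and_congr_right fun hv => ⟨fun h y hy => ?_, fun h => le_antisymm ?_ ?_⟩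
      · rw [h, dotProduct_comm]; exact hy m₀ hm₀
      · rw [← hv₀m]; exact h v₀ hv₀
      · rw [dotProduct_comm]; exact hv m₀ hm₀
    · intro heq
      rw [← heq] at h0dual
      have := h0dual.2
      simp at this
    · intro r hr
      refine ⟨rayVec_mem_polarDual r, ?_⟩
      have har : a r ≠ 0 := fun h0 => hr (by simp [h0])
      have hge : ∀ r, 0 ≤ a r * (m₀ ⬝ᵥ Δ.rayVec r + 1) := fun r =>
        mul_nonneg (ha r) (by have := mem_carrier_iff.1 hm₀ r; linarith)
      have hsum : ∑ r, a r * (m₀ ⬝ᵥ Δ.rayVec r + 1) = 0 := by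
        have e : m₀ ⬝ᵥ (h⁻¹ • w) = ∑ r, a r * (m₀ ⬝ᵥ Δ.rayVec r) := by
          rw [← haw, dotProduct_sum]; simp [dotProduct_smul]
        have e' : m₀ ⬝ᵥ (h⁻¹ • w) = -1 := by
          rw [dotProduct_smul, smul_eq_mul, ← neg_neg (m₀ ⬝ᵥ w), ← hh, mul_neg,
            inv_mul_cancel₀ hpos.ne']
        simp only [mul_add, Finset.sum_add_distrib, mul_one, ha1, ← e, e']
        norm_num
      have := (Finset.sum_eq_zero_iff_of_nonneg fun r _ => hge r).1 hsum r (Finset.mem_univ r)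
      have := (mul_eq_zero.1 this).resolve_left har
      linarith

/-! ### Nef partitions and their polytopes of sections. -/

variable {c : ℕ}

/-- The lattice points of the section polytope of `E_j`. -/
def sectionPoints (J : Δ.Ray → Fin c) (j : Fin c) : Set (Fin n → ℤ) :=
  {m | ∀ r : Δ.Ray, -partDivisor J j r ≤ m ⬝ᵥ r.gen}

/-- The lattice points of the section polytope of `E_j` whose Cox monomials are not in `I_0`. -/
def generalPoints (J : Δ.Ray → Fin c) (j : Fin c) : Set (Fin n → ℤ) :=
  {m ∈ sectionPoints J j | ∀ k, ∃ r : Δ.Ray, J r = k ∧ m ⬝ᵥ r.gen = -partDivisor J j r}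

theorem sum_partDivisor (J : Δ.Ray → Fin c) (r : Δ.Ray) :
    ∑ j, (partDivisor J j r : ℝ) = 1 := by
  simp [partDivisor]

theorem partDivisor_cast (J : Δ.Ray → Fin c) (j : Fin c) (r : Δ.Ray) :
    (partDivisor J j r : ℝ) = if J r = j then 1 else 0 := by
  simp [partDivisor]

theorem realVec_dotProduct_rayVec (m : Fin n → ℤ) (r : Δ.Ray) :
    realVec m ⬝ᵥ Δ.rayVec r = ((m ⬝ᵥ r.gen : ℤ) : ℝ) := realVec_dotProduct m r.gen

theorem realVec_dotProduct_rayVec_eq_iff (J : Δ.Ray → Fin c) (j : Fin c) (m : Fin n → ℤ)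
    (r : Δ.Ray) : realVec m ⬝ᵥ Δ.rayVec r = -(partDivisor J j r : ℝ) ↔
      m ⬝ᵥ r.gen = -partDivisor J j r := by
  rw [realVec_dotProduct_rayVec]; exact_mod_cast Iff.rfl

theorem le_dotProduct_of_mem_sectionPolytope {J : Δ.Ray → Fin c} {j : Fin c} {x : Fin n → ℝ}
    (hx : x ∈ sectionPolytope (partDivisor J j)) (r : Δ.Ray) :
    -(partDivisor J j r : ℝ) ≤ x ⬝ᵥ Δ.rayVec r := by
  have hsub : convexHull ℝ (realVec '' sectionPoints J j) ⊆
      {x | -(partDivisor J j r : ℝ) ≤ x ⬝ᵥ Δ.rayVec r} := by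
    refine convexHull_min ?_ (convex_setOf_le_dotProduct _ _)
    rintro _ ⟨m, hm, rfl⟩
    simp only [Set.mem_ofPred, realVec_dotProduct_rayVec]
    exact_mod_cast hm r
  exact hsub hx

theorem realVec_mem_carrier {J : Δ.Ray → Fin c} {j : Fin c} {m : Fin n → ℤ}
    (hm : m ∈ sectionPoints J j) : realVec m ∈ Δ.carrier := by
  rw [mem_carrier_iff]
  intro r
  rw [realVec_dotProduct_rayVec]
  have h1 := hm r
  have h2 : partDivisor J j r ≤ 1 := by unfold partDivisor; split_ifs <;> norm_num
  have : -1 ≤ m ⬝ᵥ r.gen := by linarith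
  exact_mod_cast this

theorem finite_sectionPoints (J : Δ.Ray → Fin c) (j : Fin c) : (sectionPoints J j).Finite :=
  (finite_of_isBounded_realVec Δ.isCompact_carrier.isBounded).subset
    fun _ hm => realVec_mem_carrier hm

theorem isCompact_sectionPolytope (J : Δ.Ray → Fin c) (j : Fin c) :
    IsCompact (sectionPolytope (partDivisor J j)) :=
  ((finite_sectionPoints J j).image _).isCompact_convexHull ℝ

open Classical in
-- The Cox point with zeros exactly at the rays in `F` lies off the irrelevant locus, so some
-- section of E_j is non-zero there. A monomial contributing to its value has exponent zero on those
-- rays.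
theorem IsNefPartition.exists_sectionPoint {J : Δ.Ray → Fin c} (hJ : IsNefPartition J)
    (j : Fin c) {F : Set (Fin n → ℝ)} (hF : F ∈ Δ.coneFaces) :
    ∃ m ∈ sectionPoints J j, ∀ r : Δ.Ray, Δ.rayVec r ∈ F →
      m ⬝ᵥ r.gen = -partDivisor J j r := by
  set x : Δ.Ray → ℂ := fun r => if Δ.rayVec r ∈ F then 0 else 1 with hx
  obtain ⟨f, hf, hfx⟩ := (hJ j).2 x ⟨_, Ideal.subset_span ⟨F, hF, rfl⟩, by
    rw [map_prod]
    refine Finset.prod_ne_zero_iff.2 fun r hr => ?_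
    rw [MvPolynomial.eval_X, hx]
    simp only
    rw [if_neg (show Δ.rayVec r ∉ F from (Finset.mem_filter.1 hr).2)]
    exact one_ne_zero⟩
  rw [MvPolynomial.eval_eq] at hfx
  obtain ⟨e, he, hne⟩ := Finset.exists_ne_zero_of_sum_ne_zero hfx
  obtain ⟨m, hm⟩ := hf e he
  have hprod := Finset.prod_ne_zero_iff.1 (right_ne_zero_of_mul hne)
  refine ⟨m, fun r => ?_, fun r hr => ?_⟩
  · have := hm r
    have h0 : (0 : ℤ) ≤ e r := Int.natCast_nonneg _
    linarith
  · have h0 : e r = 0 := by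
      by_contra h
      have := hprod r (Finsupp.mem_support_iff.2 h)
      rw [hx] at this
      simp only [if_pos hr] at this
      exact this (zero_pow h)
    have := hm r
    rw [h0] at this
    push_cast at this
    linarith

/-- This is linearity of the support functions on the cones of the fan: one combination serves all
`j`, and the point found in Δ_j minimises `w` there, with value `-∑ a r` over `J r = j`. -/
theorem IsNefPartition.exists_combination {J : Δ.Ray → Fin c} (hJ : IsNefPartition J)
    (w : Fin n → ℝ) :
    ∃ a : Δ.Ray → ℝ, (∀ r, 0 ≤ a r) ∧ ∑ r, a r • Δ.rayVec r = w ∧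
      ∀ j, ∃ m ∈ sectionPoints J j, ∀ r, a r ≠ 0 → m ⬝ᵥ r.gen = -partDivisor J j r := by
  obtain ⟨a, ha, haw, F, hF, haF⟩ := exists_coneFace (Δ := Δ) w
  refine ⟨a, ha, haw, fun j => ?_⟩
  obtain ⟨m, hm, hmF⟩ := hJ.exists_sectionPoint j hF
  exact ⟨m, hm, fun r hr => hmF r (haF r hr)⟩

theorem dotProduct_sum_smul_rayVec (x : Fin n → ℝ) (a : Δ.Ray → ℝ) :
    x ⬝ᵥ (∑ r, a r • Δ.rayVec r) = ∑ r, a r * (x ⬝ᵥ Δ.rayVec r) := by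
  rw [dotProduct_sum]; simp [dotProduct_smul]

theorem realVec_dotProduct_combination {J : Δ.Ray → Fin c} {j : Fin c} {a : Δ.Ray → ℝ}
    {m : Fin n → ℤ} (hm : ∀ r, a r ≠ 0 → m ⬝ᵥ r.gen = -partDivisor J j r) :
    realVec m ⬝ᵥ (∑ r, a r • Δ.rayVec r) = -∑ r, a r * partDivisor J j r := by
  rw [dotProduct_sum_smul_rayVec, ← Finset.sum_neg_distrib]
  refine Finset.sum_congr rfl fun r _ => ?_
  by_cases h : a r = 0
  · simp [h]
  · rw [(realVec_dotProduct_rayVec_eq_iff J j m r).2 (hm r h)]; ring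

/-- The reflexive polytope is the Minkowski sum of the polytopes of sections. -/
theorem IsNefPartition.exists_sum_eq {J : Δ.Ray → Fin c} (hJ : IsNefPartition J)
    {m : Fin n → ℝ} (hm : m ∈ Δ.carrier) :
    ∃ x : Fin c → Fin n → ℝ, (∀ j, x j ∈ sectionPolytope (partDivisor J j)) ∧ ∑ j, x j = m := by
  set S : Set (Fin n → ℝ) := ∑ j, sectionPolytope (partDivisor J j) with hS
  have hprop : Convex ℝ S ∧ IsCompact S := by
    refine Finset.sum_induction _ (fun S => Convex ℝ S ∧ IsCompact S)
      (fun A B hA hB => ⟨hA.1.add hB.1, hA.2.add hB.2⟩)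
      ⟨convex_singleton _, isCompact_singleton⟩
      fun j _ => ⟨convex_convexHull _ _, isCompact_sectionPolytope J j⟩
  have hmS : m ∈ S := by
    by_contra hmem
    obtain ⟨l, u, hlm, hl⟩ :=
      geometric_hahn_banach_point_closed hprop.1 hprop.2.isClosed hmem
    obtain ⟨w, hw⟩ := l.exists_eq_dotProduct
    simp only [hw] at hlm hl
    obtain ⟨a, ha, haw, hpt⟩ := hJ.exists_combination w
    choose p hp hpa using hpt
    -- Each ray lies in exactly one part, so `w` takes the value `-∑ a r` on a point of the
    -- Minkowski sum. This is also a lower bound for `w` on Δ, which contradicts the separation.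
    have h1 := hl (∑ j, realVec (p j)) (Set.finsetSum_mem_finsetSum _ _ _ fun j _ =>
      subset_convexHull ℝ _ ⟨p j, hp j, rfl⟩)
    have h2 : (∑ j, realVec (p j)) ⬝ᵥ w = -∑ r, a r := by
      rw [sum_dotProduct, ← haw]
      simp only [realVec_dotProduct_combination (hpa _)]
      rw [Finset.sum_neg_distrib, Finset.sum_comm]
      simp only [← Finset.mul_sum, sum_partDivisor, mul_one]
    have h3 : -∑ r, a r ≤ m ⬝ᵥ w := by
      rw [← haw, dotProduct_sum_smul_rayVec, ← Finset.sum_neg_distrib]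
      refine Finset.sum_le_sum fun r _ => ?_
      have := mul_le_mul_of_nonneg_left (mem_carrier_iff.1 hm r) (ha r)
      linarith
    linarith
  obtain ⟨x, hx, hxm⟩ := (Set.mem_fintype_sum _ _).1 hmS
  exact ⟨x, hx, hxm⟩

theorem sum_mem_carrier {J : Δ.Ray → Fin c} {x : Fin c → Fin n → ℝ}
    (hx : ∀ j, x j ∈ sectionPolytope (partDivisor J j)) : ∑ j, x j ∈ Δ.carrier := by
  rw [mem_carrier_iff]
  intro r
  rw [sum_dotProduct, ← sum_partDivisor J r, ← Finset.sum_neg_distrib]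
  exact Finset.sum_le_sum fun j _ => le_dotProduct_of_mem_sectionPolytope (hx j) r

/-- An exposed face of the polytope is cut out by the facets that contain it. -/
theorem IsNefPartition.mem_of_isExposed {J : Δ.Ray → Fin c} (hJ : IsNefPartition J)
    {G : Set (Fin n → ℝ)} (hG : IsExposed ℝ Δ.carrier G) (hne : G.Nonempty) {m : Fin n → ℝ}
    (hm : m ∈ Δ.carrier)
    (hmG : ∀ r, (∀ y ∈ G, y ⬝ᵥ Δ.rayVec r = -1) → m ⬝ᵥ Δ.rayVec r = -1) : m ∈ G := by
  obtain ⟨l, rfl⟩ := hG hne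
  obtain ⟨w, hw⟩ := (-l).exists_eq_dotProduct
  have hl : ∀ x, l x = -(x ⬝ᵥ w) := fun x => by rw [← hw]; simp
  simp only [hl, neg_le_neg_iff] at hmG ⊢
  obtain ⟨a, ha, haw, hpt⟩ := hJ.exists_combination w
  choose p hp hpa using hpt
  have hge : ∀ x ∈ Δ.carrier, ∀ r, 0 ≤ a r * (x ⬝ᵥ Δ.rayVec r + 1) := fun x hx r =>
    mul_nonneg (ha r) (by have := mem_carrier_iff.1 hx r; linarith)
  have hval : ∀ x, x ⬝ᵥ w = ∑ r, a r * (x ⬝ᵥ Δ.rayVec r + 1) - ∑ r, a r := by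
    intro x
    rw [← haw, dotProduct_sum_smul_rayVec, ← Finset.sum_sub_distrib]
    exact Finset.sum_congr rfl fun r _ => by ring
  have hp₀ : (∑ j, realVec (p j)) ⬝ᵥ w = -∑ r, a r := by
    rw [sum_dotProduct, ← haw]
    simp only [realVec_dotProduct_combination (hpa _)]
    rw [Finset.sum_neg_distrib, Finset.sum_comm]
    simp only [← Finset.mul_sum, sum_partDivisor, mul_one]
  have hp₀mem : ∑ j, realVec (p j) ∈ Δ.carrier :=
    sum_mem_carrier fun j => subset_convexHull ℝ _ ⟨p j, hp j, rfl⟩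
  refine ⟨hm, fun y hy => ?_⟩
  have hmw : ∑ r, a r * (m ⬝ᵥ Δ.rayVec r + 1) = 0 := by
    refine Finset.sum_eq_zero fun r _ => ?_
    by_cases har : a r = 0
    · simp [har]
    · rw [hmG r]
      · simp
      · rintro z ⟨hz, hzmin⟩
        -- The minimum of `w` over Δ is `-∑ a r`, attained at the sum of the `p j`. Hence every ray
        -- with `a r ≠ 0` is tight on the face, and by `hmG` at `m`.
        have h1 := hzmin _ hp₀mem
        rw [hp₀, hval z] at h1
        have h2 : ∑ r, a r * (z ⬝ᵥ Δ.rayVec r + 1) = 0 :=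
          le_antisymm (by linarith) (Finset.sum_nonneg fun r _ => hge z hz r)
        have h3 := (Finset.sum_eq_zero_iff_of_nonneg fun r _ => hge z hz r).1 h2 r
          (Finset.mem_univ r)
        have := (mul_eq_zero.1 h3).resolve_left har
        linarith
  rw [hval m, hval y, hmw]
  have := Finset.sum_nonneg fun r (_ : r ∈ Finset.univ) => hge y hy r
  linarith

/-! ### Tropical points as weights along the parts. -/

/-- A weight with coefficients along the rays summing to one over each part of the partition. -/
structure IsPartWeight (J : Δ.Ray → Fin c) (a : Δ.Ray → ℝ) : Prop where
  nonneg : ∀ r, 0 ≤ a r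
  sum_eq_one : ∀ j, ∑ r, a r * partDivisor J j r = 1

theorem IsPartWeight.exists_ne_zero {J : Δ.Ray → Fin c} {a : Δ.Ray → ℝ} (ha : IsPartWeight J a)
    (j : Fin c) : ∃ r, J r = j ∧ a r ≠ 0 := by
  by_contra! h
  have := ha.sum_eq_one j
  rw [Finset.sum_eq_zero] at this
  · exact zero_ne_one this
  · intro r _
    by_cases hr : J r = j
    · rw [h r hr, zero_mul]
    · rw [partDivisor_cast, if_neg hr, mul_zero]

theorem IsPartWeight.neg_one_le {J : Δ.Ray → Fin c} {a : Δ.Ray → ℝ} (ha : IsPartWeight J a)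
    {j : Fin c} {x : Fin n → ℝ} (hx : x ∈ sectionPolytope (partDivisor J j)) :
    -1 ≤ x ⬝ᵥ (∑ r, a r • Δ.rayVec r) := by
  rw [← ha.sum_eq_one j, dotProduct_sum_smul_rayVec, ← Finset.sum_neg_distrib]
  refine Finset.sum_le_sum fun r _ => ?_
  have := mul_le_mul_of_nonneg_left (le_dotProduct_of_mem_sectionPolytope hx r) (ha.nonneg r)
  linarith

theorem IsPartWeight.eq_neg_one_iff {J : Δ.Ray → Fin c} {a : Δ.Ray → ℝ} (ha : IsPartWeight J a)
    {j : Fin c} {x : Fin n → ℝ} (hx : x ∈ sectionPolytope (partDivisor J j)) :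
    x ⬝ᵥ (∑ r, a r • Δ.rayVec r) = -1 ↔
      ∀ r, a r ≠ 0 → x ⬝ᵥ Δ.rayVec r = -partDivisor J j r := by
  have hge : ∀ r ∈ Finset.univ, 0 ≤ a r * (x ⬝ᵥ Δ.rayVec r + partDivisor J j r) := fun r _ =>
    mul_nonneg (ha.nonneg r) (by have := le_dotProduct_of_mem_sectionPolytope hx r; linarith)
  have hsum : x ⬝ᵥ (∑ r, a r • Δ.rayVec r) + 1
      = ∑ r, a r * (x ⬝ᵥ Δ.rayVec r + partDivisor J j r) := by
    simp only [mul_add, Finset.sum_add_distrib]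
    rw [ha.sum_eq_one j, dotProduct_sum_smul_rayVec]
  rw [eq_neg_iff_add_eq_zero, hsum, Finset.sum_eq_zero_iff_of_nonneg hge]
  constructor
  · intro h r hr
    have := (mul_eq_zero.1 (h r (Finset.mem_univ r))).resolve_left hr
    linarith
  · intro h r _
    by_cases hr : a r = 0
    · simp [hr]
    · rw [h r hr]; ring

/-- Each part contains a ray with `a r ≠ 0`, and `m` is tight there. So every part has a variable
missing from the Cox monomial of `m`, and no m_k divides it. -/
theorem IsPartWeight.mem_generalPoints {J : Δ.Ray → Fin c} {a : Δ.Ray → ℝ}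
    (ha : IsPartWeight J a) {j : Fin c} {m : Fin n → ℤ} (hm : m ∈ sectionPoints J j)
    (h : realVec m ⬝ᵥ (∑ r, a r • Δ.rayVec r) = -1) : m ∈ generalPoints J j := by
  refine ⟨hm, fun k => ?_⟩
  obtain ⟨r, hr, har⟩ := ha.exists_ne_zero k
  refine ⟨r, hr, (realVec_dotProduct_rayVec_eq_iff J j m r).1 ?_⟩
  exact (ha.eq_neg_one_iff (subset_convexHull ℝ _ ⟨m, hm, rfl⟩)).1 h r har

/-- The points of `ℝ ⊕ N_ℝ` at which no monomial of `t g_j` has smaller weight than `m_j`. -/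
def specialCone (J : Δ.Ray → Fin c) : Set (ℝ × (Fin n → ℝ)) :=
  {u | ∀ j, ∀ m ∈ generalPoints J j, 0 ≤ u.1 + realVec m ⬝ᵥ u.2}

/-- The points of the weight polytope at which every `t g_j + m_j` has an initial form with at
least two terms. -/
def IsTropicalPoint (J : Δ.Ray → Fin c) (w : Fin n → ℝ) : Prop :=
  ((1 : ℝ), w) ∈ specialCone J ∧ ∀ j, ∃ m ∈ generalPoints J j, realVec m ⬝ᵥ w = -1

/-- Write `w` as a combination along a cone, with minimisers `p j`. The point of Δ_j with value `-1`
forces total weight at least 1 on each part, so `a` is non-zero somewhere on each part. There `p j`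
is tight, which makes it general, and the cone inequality at `p j` bounds the total weight above by
1. -/
theorem IsTropicalPoint.exists_isPartWeight {J : Δ.Ray → Fin c} (hJ : IsNefPartition J)
    {w : Fin n → ℝ} (hw : IsTropicalPoint J w) :
    ∃ a, IsPartWeight J a ∧ w = ∑ r, a r • Δ.rayVec r := by
  obtain ⟨a, ha, haw, hpt⟩ := hJ.exists_combination w
  choose p hp hpa using hpt
  have hge : ∀ j, 1 ≤ ∑ r, a r * partDivisor J j r := by
    intro j
    obtain ⟨m, hm, hmw⟩ := hw.2 j
    rw [← haw, dotProduct_sum_smul_rayVec] at hmw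
    have : -∑ r, a r * (partDivisor J j r : ℝ) ≤ ∑ r, a r * (realVec m ⬝ᵥ Δ.rayVec r) := by
      rw [← Finset.sum_neg_distrib]
      refine Finset.sum_le_sum fun r _ => ?_
      have := mul_le_mul_of_nonneg_left (le_dotProduct_of_mem_sectionPolytope
        (subset_convexHull ℝ _ ⟨m, hm.1, rfl⟩) r) (ha r)
      linarith
    linarith
  refine ⟨a, ⟨ha, fun j => le_antisymm ?_ (hge j)⟩, haw.symm⟩
  have hpg : p j ∈ generalPoints J j := by
    refine ⟨hp j, fun k => ?_⟩
    by_contra! h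
    have := hge k
    rw [Finset.sum_eq_zero] at this
    · linarith
    · intro r _
      by_cases hr : J r = k
      · by_cases har : a r = 0
        · rw [har, zero_mul]
        · exact absurd (hpa j r har) (h r hr)
      · rw [partDivisor_cast, if_neg hr, mul_zero]
  have h1 := hw.1 j (p j) hpg
  rw [← haw, realVec_dotProduct_combination (hpa j)] at h1
  linarith

/-- `specialCone` constrains general points only; the part weight extends the bound to the whole
polytope of sections. -/
theorem IsTropicalPoint.neg_one_le {J : Δ.Ray → Fin c} (hJ : IsNefPartition J)
    {w : Fin n → ℝ} (hw : IsTropicalPoint J w) {j : Fin c} {x : Fin n → ℝ}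
    (hx : x ∈ sectionPolytope (partDivisor J j)) : -1 ≤ x ⬝ᵥ w := by
  obtain ⟨a, ha, rfl⟩ := hw.exists_isPartWeight hJ
  exact ha.neg_one_le hx

/-! ### The ideal I_0 and its strata in terms of exponents. -/

/-- The exponent vector of the monomial `m_j`. -/
def partExponent (J : Δ.Ray → Fin c) (j : Fin c) : Δ.Ray →₀ ℕ :=
  Finsupp.equivFunOnFinite.symm fun r => if J r = j then 1 else 0

theorem partExponent_apply (J : Δ.Ray → Fin c) (j : Fin c) (r : Δ.Ray) :
    partExponent J j r = if J r = j then 1 else 0 := rfl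

theorem partMonomial_eq (J : Δ.Ray → Fin c) (j : Fin c) :
    partMonomial J j = MvPolynomial.monomial (partExponent J j) 1 := by
  classical
  rw [MvPolynomial.monomial_eq, Finsupp.prod_fintype _ _ (by simp), partMonomial,
    Finset.prod_filter, MvPolynomial.C_1, one_mul]
  refine Finset.prod_congr rfl fun r _ => ?_
  rw [partExponent_apply]
  split_ifs <;> simp

theorem specialFibreIdeal_eq (J : Δ.Ray → Fin c) : specialFibreIdeal J =
    Ideal.span ((fun e => MvPolynomial.monomial e (1 : ℂ)) '' Set.range (partExponent J)) := by
  rw [specialFibreIdeal, ← Set.range_comp]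
  congr 2
  exact funext (partMonomial_eq J)

theorem partExponent_le_iff (J : Δ.Ray → Fin c) (j : Fin c) (e : Δ.Ray →₀ ℕ) :
    partExponent J j ≤ e ↔ ∀ r, J r = j → 1 ≤ e r := by
  refine ⟨fun h r hr => ?_, fun h r => ?_⟩
  · have := h r
    rwa [partExponent_apply, if_pos hr] at this
  · rw [partExponent_apply]
    split_ifs with hr
    exacts [h r hr, Nat.zero_le _]

theorem monomial_mem_specialFibreIdeal_iff (J : Δ.Ray → Fin c) (e : Δ.Ray →₀ ℕ) :
    MvPolynomial.monomial e (1 : ℂ) ∈ specialFibreIdeal J ↔ ∃ j, partExponent J j ≤ e := by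
  classical
  rw [specialFibreIdeal_eq, MvPolynomial.mem_ideal_span_monomial_image,
    MvPolynomial.support_monomial, if_neg one_ne_zero]
  simp

theorem specialFibreIdeal_le_iff (J : Δ.Ray → Fin c) (P : Δ.Ray → Prop) :
    specialFibreIdeal J ≤ Ideal.span {x | ∃ r : Δ.Ray, P r ∧ x = MvPolynomial.X r} ↔
      ∀ j, ∃ r, J r = j ∧ P r := by
  classical
  have hset : {x : Δ.CoxRing | ∃ r : Δ.Ray, P r ∧ x = MvPolynomial.X r}
      = MvPolynomial.X '' {r | P r} := by
    ext x; simp [eq_comm]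
  rw [hset, specialFibreIdeal, Ideal.span_le, Set.range_subset_iff]
  refine forall_congr' fun j => ?_
  rw [SetLike.mem_coe, partMonomial_eq, MvPolynomial.mem_ideal_span_X_image,
    MvPolynomial.support_monomial, if_neg one_ne_zero]
  simp [partExponent_apply, and_comm]

theorem mem_strata_iff (J : Δ.Ray → Fin c) (G : Set (Fin n → ℝ)) :
    G ∈ strata (specialFibreIdeal J) ↔ IsBoundaryFace Δ.carrier G ∧
      ∀ j, ∃ r, J r = j ∧ ∀ m ∈ G, m ⬝ᵥ Δ.rayVec r = -1 := by
  rw [← specialFibreIdeal_le_iff J fun r => ∀ m ∈ G, m ⬝ᵥ Δ.rayVec r = -1]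
  rfl

theorem nonempty_ray (Δ : ReflexivePolytope n) : Nonempty Δ.Ray := by
  by_contra h
  rw [not_nonempty_iff] at h
  have h0 : (0 : Fin n → ℝ) ∈ polarDual Δ.carrier := interior_subset Δ.zero_mem_interior_dual
  rw [polarDual_eq_convexHull, Set.range_eq_empty, convexHull_empty] at h0
  exact h0

/-! ### Tropical slices and the corresponding faces of Δ. -/

/-- A convex set of special fibre weights over which every initial form has two common terms. -/
structure IsTropicalSlice (J : Δ.Ray → Fin c) (F : Set (Fin n → ℝ)) : Prop where
  convex : Convex ℝ F
  nonempty : F.Nonempty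
  mem_specialCone : ∀ w ∈ F, ((1 : ℝ), w) ∈ specialCone J
  exists_generalPoint : ∀ j, ∃ m ∈ generalPoints J j, ∀ w ∈ F, realVec m ⬝ᵥ w = -1

theorem IsTropicalSlice.isTropicalPoint {J : Δ.Ray → Fin c} {F : Set (Fin n → ℝ)}
    (hF : IsTropicalSlice J F) {w : Fin n → ℝ} (hw : w ∈ F) : IsTropicalPoint J w :=
  ⟨hF.mem_specialCone w hw, fun j => by
    obtain ⟨m, hm, h⟩ := hF.exists_generalPoint j
    exact ⟨m, hm, h w hw⟩⟩

/-- A point of a tropical slice whose initial forms are those common to all of the slice. -/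
theorem IsTropicalSlice.exists_generic {J : Δ.Ray → Fin c} (hJ : IsNefPartition J)
    {F : Set (Fin n → ℝ)} (hF : IsTropicalSlice J F) :
    ∃ w₀ ∈ F, ∀ j, ∀ m ∈ sectionPoints J j, realVec m ⬝ᵥ w₀ = -1 →
      ∀ w ∈ F, realVec m ⬝ᵥ w = -1 := by
  obtain ⟨w₀, hw₀, h⟩ := hF.convex.exists_generic hF.nonempty
    (S := ⋃ j, realVec '' sectionPoints J j)
    (Set.finite_iUnion fun j => (finite_sectionPoints J j).image _) (by
      intro m' hm' w hw
      obtain ⟨j, m, hm, rfl⟩ := Set.mem_iUnion.1 hm'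
      exact (hF.isTropicalPoint hw).neg_one_le hJ (subset_convexHull ℝ _ ⟨m, hm, rfl⟩))
  exact ⟨w₀, hw₀, fun j m hm => h _ (Set.mem_iUnion.2 ⟨j, m, hm, rfl⟩)⟩

/-- A face of a lattice polytope is spanned by the lattice points it contains, and those with value
`-1` are automatically general. Relations known for general points thus pass to the face. -/
theorem IsTropicalPoint.mem_convexHull {J : Δ.Ray → Fin c} (hJ : IsNefPartition J)
    {w : Fin n → ℝ} (hw : IsTropicalPoint J w) {j : Fin c} {x : Fin n → ℝ}
    (hx : x ∈ sectionPolytope (partDivisor J j)) (hxw : x ⬝ᵥ w = -1) :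
    x ∈ convexHull ℝ (realVec '' {m ∈ generalPoints J j | realVec m ⬝ᵥ w = -1}) := by
  obtain ⟨a, ha, rfl⟩ := hw.exists_isPartWeight hJ
  have h := mem_convexHull_face (b := -1) (w := ∑ r, a r • Δ.rayVec r)
    (by rintro _ ⟨m, hm, rfl⟩
        exact ha.neg_one_le (subset_convexHull ℝ _ ⟨m, hm, rfl⟩)) hx hxw
  refine convexHull_mono ?_ h
  rintro _ ⟨⟨m, hm, rfl⟩, hmw⟩
  exact ⟨m, ⟨ha.mem_generalPoints hm hmw, hmw⟩, rfl⟩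

/-- Only membership in the polar of ∇ is at issue: such an `x` is a convex combination of general
points, and these are at least `-1` on ∇ by definition of the cone. -/
theorem IsTropicalSlice.dualFace_inter {J : Δ.Ray → Fin c} (hJ : IsNefPartition J)
    {F : Set (Fin n → ℝ)} (hF : IsTropicalSlice J F) (j : Fin c) :
    dualFace {w | ((1 : ℝ), w) ∈ specialCone J} F ∩ sectionPolytope (partDivisor J j)
      = {x ∈ sectionPolytope (partDivisor J j) | ∀ w ∈ F, x ⬝ᵥ w = -1} := by
  ext x
  refine ⟨fun h => ⟨h.2, h.1.2⟩, fun h => ⟨⟨?_, h.2⟩, h.1⟩⟩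
  obtain ⟨w, hw⟩ := hF.nonempty
  have hx := (hF.isTropicalPoint hw).mem_convexHull hJ h.1 (h.2 w hw)
  refine convexHull_min ?_ (convex_polarDual _) hx
  rintro _ ⟨m, ⟨hm, -⟩, rfl⟩ v hv
  have h1 : 0 ≤ (1 : ℝ) + realVec m ⬝ᵥ v := hv j m hm
  linarith

/-- Decompose a point of Δ into summands from the Δ_j. Each is at least `-1` on `F`, so the total is
`-c` only if each equals `-1`. -/
theorem IsTropicalSlice.minkowskiMap_eq {J : Δ.Ray → Fin c} (hJ : IsNefPartition J)
    {F : Set (Fin n → ℝ)} (hF : IsTropicalSlice J F) :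
    minkowskiMap J (dualFace {w | ((1 : ℝ), w) ∈ specialCone J} F)
      = {x ∈ Δ.carrier | ∀ w ∈ F, x ⬝ᵥ w = -c} := by
  unfold minkowskiMap
  simp only [hF.dualFace_inter hJ]
  ext y
  rw [Set.mem_fintype_sum]
  constructor
  · rintro ⟨x, hx, rfl⟩
    refine ⟨sum_mem_carrier fun j => (hx j).1, fun w hw => ?_⟩
    rw [sum_dotProduct, Finset.sum_congr rfl fun j _ => (hx j).2 w hw]
    simp
  · rintro ⟨hy, hyF⟩
    obtain ⟨x, hx, rfl⟩ := hJ.exists_sum_eq hy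
    refine ⟨x, fun j => ⟨hx j, fun w hw => ?_⟩, rfl⟩
    have h1 := hyF w hw
    have hge : ∀ j ∈ Finset.univ, 0 ≤ x j ⬝ᵥ w + 1 := fun j _ => by
      have := (hF.isTropicalPoint hw).neg_one_le hJ (hx j); linarith
    have h2 : ∑ j, (x j ⬝ᵥ w + 1) = 0 := by
      rw [sum_dotProduct] at h1
      rw [Finset.sum_add_distrib, h1]; simp
    have := (Finset.sum_eq_zero_iff_of_nonneg hge).1 h2 j (Finset.mem_univ j)
    linarith

/-- The Minkowski sum of the generic faces of the section polytopes depends only on a generic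
point. -/
theorem IsTropicalSlice.eq_of_generic {J : Δ.Ray → Fin c} (hJ : IsNefPartition J)
    {F : Set (Fin n → ℝ)} (hF : IsTropicalSlice J F) {w₀ : Fin n → ℝ} (hw₀ : w₀ ∈ F)
    (hgen : ∀ j, ∀ m ∈ generalPoints J j, realVec m ⬝ᵥ w₀ = -1 →
      ∀ w ∈ F, realVec m ⬝ᵥ w = -1) :
    {x ∈ Δ.carrier | ∀ w ∈ F, x ⬝ᵥ w = -c} = {x ∈ Δ.carrier | x ⬝ᵥ w₀ = -c} := by
  ext y
  refine ⟨fun h => ⟨h.1, h.2 w₀ hw₀⟩, fun ⟨hy, hyw⟩ => ⟨hy, fun w hw => ?_⟩⟩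
  obtain ⟨x, hx, rfl⟩ := hJ.exists_sum_eq hy
  have htrop := hF.isTropicalPoint hw₀
  have hge : ∀ j ∈ Finset.univ, 0 ≤ x j ⬝ᵥ w₀ + 1 := fun j _ => by
    have := htrop.neg_one_le hJ (hx j); linarith
  have h2 : ∑ j, (x j ⬝ᵥ w₀ + 1) = 0 := by
    rw [sum_dotProduct] at hyw
    rw [Finset.sum_add_distrib, hyw]; simp
  have h3 : ∀ j, x j ⬝ᵥ w₀ = -1 := fun j => by
    have := (Finset.sum_eq_zero_iff_of_nonneg hge).1 h2 j (Finset.mem_univ j); linarith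
  have h4 : ∀ j, x j ⬝ᵥ w = -1 := fun j => by
    have hmem := htrop.mem_convexHull hJ (hx j) (h3 j)
    have hlin : IsLinearMap ℝ fun x : Fin n → ℝ => x ⬝ᵥ w :=
      ⟨fun _ _ => add_dotProduct _ _ _, fun _ _ => smul_dotProduct _ _ _⟩
    refine convexHull_min (t := {x | x ⬝ᵥ w = -1}) ?_ (convex_hyperplane hlin _) hmem
    rintro _ ⟨m, ⟨hm, hmw⟩, rfl⟩
    exact hgen j m hm hmw w hw
  rw [sum_dotProduct, Finset.sum_congr rfl fun j _ => h4 j]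
  simp

/-- The value `-c` is the minimum over Δ, attained at a sum of general points and different from the
value at 0. In each part a ray with `a r ≠ 0` is tight on every summand, hence takes the value `-1`
on the face. -/
theorem IsTropicalPoint.face_mem_strata {J : Δ.Ray → Fin c} (hJ : IsNefPartition J)
    {w : Fin n → ℝ} (hw : IsTropicalPoint J w) :
    {x ∈ Δ.carrier | x ⬝ᵥ w = -c} ∈ strata (specialFibreIdeal J) := by
  obtain ⟨a, ha, rfl⟩ := hw.exists_isPartWeight hJ
  set w := ∑ r, a r • Δ.rayVec r with hwdef
  have hsplit : ∀ x : Fin c → Fin n → ℝ, (∑ j, x j) ⬝ᵥ w + c = ∑ j, (x j ⬝ᵥ w + 1) := by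
    intro x
    rw [sum_dotProduct, Finset.sum_add_distrib]; simp
  have hge : ∀ x ∈ Δ.carrier, -(c : ℝ) ≤ x ⬝ᵥ w := by
    intro y hy
    obtain ⟨x, hx, rfl⟩ := hJ.exists_sum_eq hy
    have := hsplit x
    have := Finset.sum_nonneg (s := Finset.univ) (f := fun j => x j ⬝ᵥ w + 1) fun j _ => by
      have := ha.neg_one_le (hx j); linarith
    linarith
  have hne : {x ∈ Δ.carrier | x ⬝ᵥ w = -c}.Nonempty := by
    choose m hm hmw using hw.2
    refine ⟨∑ j, realVec (m j),
      sum_mem_carrier fun j => subset_convexHull ℝ _ ⟨m j, (hm j).1, rfl⟩, ?_⟩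
    have := hsplit fun j => realVec (m j)
    have h0 : ∑ j, (realVec (m j) ⬝ᵥ w + 1) = 0 :=
      Finset.sum_eq_zero fun j _ => by rw [hmw j]; norm_num
    linarith
  have hcpos : (0 : ℝ) < c := by
    obtain ⟨r⟩ := nonempty_ray Δ
    exact_mod_cast (J r).pos
  rw [mem_strata_iff]
  refine ⟨⟨fun _ => ⟨LinearMap.toContinuousLinearMap (-(dotProductEquiv ℝ (Fin n) w)), ?_⟩, hne,
    fun heq => ?_⟩, fun j => ?_⟩
  · ext x
    simp only [Set.mem_ofPred, LinearMap.coe_toContinuousLinearMap', LinearMap.neg_apply,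
      dotProductEquiv_apply_apply, neg_le_neg_iff, dotProduct_comm w]
    refine and_congr_right fun hx => ⟨fun h y hy => h ▸ hge y hy, fun h => ?_⟩
    obtain ⟨x₀, hx₀, hx₀w⟩ := hne
    exact le_antisymm (hx₀w ▸ h x₀ hx₀) (hge x hx)
  · have h0 := Δ.zero_mem_carrier
    rw [← heq] at h0
    have := h0.2
    rw [zero_dotProduct] at this
    linarith
  · obtain ⟨r, hr, har⟩ := ha.exists_ne_zero j
    refine ⟨r, hr, fun y hy => ?_⟩
    obtain ⟨hy, hyw⟩ := hy
    obtain ⟨x, hx, rfl⟩ := hJ.exists_sum_eq hy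
    have hge' : ∀ j ∈ Finset.univ, 0 ≤ x j ⬝ᵥ w + 1 := fun j _ => by
      have := ha.neg_one_le (hx j); linarith
    have h2 : ∑ j, (x j ⬝ᵥ w + 1) = 0 := by rw [← hsplit, hyw]; ring
    have h3 : ∀ j, x j ⬝ᵥ w = -1 := fun j => by
      have := (Finset.sum_eq_zero_iff_of_nonneg hge').1 h2 j (Finset.mem_univ j); linarith
    rw [sum_dotProduct, Finset.sum_congr rfl fun j _ =>
      (ha.eq_neg_one_iff (hx j)).1 (h3 j) r har, Finset.sum_neg_distrib, sum_partDivisor]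

/-- Every stratum is the face on which some tropical point takes its minimum. -/
theorem exists_isTropicalPoint_of_mem_strata {J : Δ.Ray → Fin c} (hJ : IsNefPartition J)
    {G : Set (Fin n → ℝ)} (hG : G ∈ strata (specialFibreIdeal J)) :
    ∃ w, IsTropicalPoint J w ∧ G = {x ∈ Δ.carrier | x ⬝ᵥ w = -c} := by
  classical
  rw [mem_strata_iff] at hG
  obtain ⟨⟨hexp, hne, -⟩, hpart⟩ := hG
  set R : Finset Δ.Ray := Finset.univ.filter fun r => ∀ m ∈ G, m ⬝ᵥ Δ.rayVec r = -1 with hR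
  have hmemR : ∀ r, r ∈ R ↔ ∀ m ∈ G, m ⬝ᵥ Δ.rayVec r = -1 := fun r => by simp [hR]
  have hcard : ∀ j, (0 : ℝ) < (R.filter fun r => J r = j).card := fun j => by
    obtain ⟨r, hr, hrG⟩ := hpart j
    exact_mod_cast Finset.card_pos.2 ⟨r, Finset.mem_filter.2 ⟨(hmemR r).2 hrG, hr⟩⟩
  -- Uniform weight over the rays of each part whose facets contain `G`; `hcard` ensures that there
  -- are some.
  set a : Δ.Ray → ℝ := fun r =>
    if r ∈ R then ((R.filter fun r' => J r' = J r).card : ℝ)⁻¹ else 0 with ha_def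
  have hane : ∀ r, a r ≠ 0 ↔ r ∈ R := fun r => by
    simp only [ha_def]
    split_ifs with h
    · simpa [h] using (hcard (J r)).ne'
    · simp [h]
  have ha : IsPartWeight J a := by
    refine ⟨fun r => ?_, fun j => ?_⟩
    · simp only [ha_def]; split_ifs <;> positivity
    · have : ∀ r, a r * (partDivisor J j r : ℝ)
          = if r ∈ R.filter (fun r => J r = j)
              then ((R.filter fun r' => J r' = j).card : ℝ)⁻¹ else 0 := by
        intro r
        rw [partDivisor_cast]
        simp only [ha_def, Finset.mem_filter]
        by_cases h1 : r ∈ R <;> by_cases h2 : J r = j <;> simp [h1, h2]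
      simp only [this]
      rw [Finset.sum_ite_mem, Finset.univ_inter, Finset.sum_const, nsmul_eq_mul,
        mul_inv_cancel₀ (hcard j).ne']
  -- For a ray in `R` the lower bounds of the summands add up to `-1`, the value of the sum, so
  -- every summand is tight.
  have hface : ∀ x : Fin c → Fin n → ℝ, (∀ j, x j ∈ sectionPolytope (partDivisor J j)) →
      ∑ j, x j ∈ G → ∀ j, x j ⬝ᵥ (∑ r, a r • Δ.rayVec r) = -1 := by
    intro x hx hxG j
    rw [ha.eq_neg_one_iff (hx j)]
    intro r hr
    have h1 := (hmemR r).1 ((hane r).1 hr) _ hxG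
    have hge : ∀ j ∈ Finset.univ, 0 ≤ x j ⬝ᵥ Δ.rayVec r + partDivisor J j r := fun j _ => by
      have := le_dotProduct_of_mem_sectionPolytope (hx j) r; linarith
    have h2 : ∑ j, (x j ⬝ᵥ Δ.rayVec r + partDivisor J j r) = 0 := by
      rw [Finset.sum_add_distrib, ← sum_dotProduct, h1, sum_partDivisor]; ring
    have := (Finset.sum_eq_zero_iff_of_nonneg hge).1 h2 j (Finset.mem_univ j)
    linarith
  refine ⟨∑ r, a r • Δ.rayVec r, ⟨fun j m hm => ?_, fun j => ?_⟩, ?_⟩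
  · have := ha.neg_one_le (subset_convexHull ℝ _ ⟨m, hm.1, rfl⟩ :
      realVec m ∈ sectionPolytope (partDivisor J j))
    simp only
    linarith
  · obtain ⟨y, hy⟩ := hne
    obtain ⟨x, hx, rfl⟩ := hJ.exists_sum_eq (hexp.subset hy)
    have h := mem_convexHull_face (b := -1) (w := ∑ r, a r • Δ.rayVec r)
      (by rintro _ ⟨m, hm, rfl⟩
          exact ha.neg_one_le (subset_convexHull ℝ _ ⟨m, hm, rfl⟩)) (hx j) (hface x hx hy j)
    obtain ⟨_, ⟨⟨m, hm, rfl⟩, hmw⟩⟩ := convexHull_nonempty_iff.1 ⟨_, h⟩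
    exact ⟨m, ha.mem_generalPoints hm hmw, hmw⟩
  · ext y
    constructor
    · intro hy
      refine ⟨hexp.subset hy, ?_⟩
      obtain ⟨x, hx, rfl⟩ := hJ.exists_sum_eq (hexp.subset hy)
      rw [sum_dotProduct, Finset.sum_congr rfl fun j _ => hface x hx hy j]
      simp
    · rintro ⟨hy, hyw⟩
      -- Conversely, the value `-c` forces tightness on all of `R`, and the facets containing `G`
      -- cut out `G`.
      refine hJ.mem_of_isExposed hexp hne hy fun r hr => ?_
      obtain ⟨x, hx, rfl⟩ := hJ.exists_sum_eq hy
      have hge : ∀ j ∈ Finset.univ, 0 ≤ x j ⬝ᵥ (∑ r, a r • Δ.rayVec r) + 1 := fun j _ => by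
        have := ha.neg_one_le (hx j); linarith
      have h2 : ∑ j, (x j ⬝ᵥ (∑ r, a r • Δ.rayVec r) + 1) = 0 := by
        rw [sum_dotProduct] at hyw
        rw [Finset.sum_add_distrib, hyw]; simp
      have h3 : ∀ j, x j ⬝ᵥ (∑ r, a r • Δ.rayVec r) = -1 := fun j => by
        have := (Finset.sum_eq_zero_iff_of_nonneg hge).1 h2 j (Finset.mem_univ j); linarith
      rw [sum_dotProduct, Finset.sum_congr rfl fun j _ =>
        (ha.eq_neg_one_iff (hx j)).1 (h3 j) r ((hane r).2 ((hmemR r).2 hr)),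
        Finset.sum_neg_distrib, sum_partDivisor]

/-! ### The Gröbner cone in terms of general points. -/

/-- The exponent vector of the monomial `m_j` in `ℂ[t] ⊗ S`. -/
def familyExponent (J : Δ.Ray → Fin c) (j : Fin c) : Option Δ.Ray →₀ ℕ :=
  (partExponent J j).mapDomain some

theorem mapDomain_some_none (e : Δ.Ray →₀ ℕ) : e.mapDomain some none = 0 :=
  Finsupp.mapDomain_of_notMem_range _ _ (by simp)

theorem mapDomain_some_some (e : Δ.Ray →₀ ℕ) (r : Δ.Ray) : e.mapDomain some (some r) = e r :=
  Finsupp.mapDomain_apply (Option.some_injective _) _ _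

theorem toFamily_partMonomial (J : Δ.Ray → Fin c) (j : Fin c) :
    toFamily (partMonomial J j) = MvPolynomial.monomial (familyExponent J j) 1 := by
  rw [partMonomial_eq, toFamily, MvPolynomial.rename_monomial]; rfl

theorem coprimeExponents_familyExponent (J : Δ.Ray → Fin c) :
    CoprimeExponents (none : Option Δ.Ray) (familyExponent J) where
  apply_eq_zero _ := mapDomain_some_none _
  disjoint i j hij := by
    rintro (_ | r)
    · exact Or.inl (mapDomain_some_none _)
    · simp only [familyExponent, mapDomain_some_some, partExponent_apply]
      by_cases h : J r = i
      · exact Or.inr (if_neg fun h' => hij (h.symm.trans h'))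
      · exact Or.inl (if_neg h)

theorem degenerationIdeal_eq (J : Δ.Ray → Fin c) (g : Fin c → Δ.CoxRing) :
    degenerationIdeal J g = Ideal.span (Set.range fun j =>
      MvPolynomial.X none * toFamily (g j) +
        MvPolynomial.monomial (familyExponent J j) (1 : ℂ)) := by
  simp only [degenerationIdeal, toFamily_partMonomial]

theorem map_specialFibreIdeal (J : Δ.Ray → Fin c) :
    (specialFibreIdeal J).map (toFamily : Δ.CoxRing →ₐ[ℂ] Δ.FamilyRing) =
      Ideal.span (Set.range fun j => MvPolynomial.monomial (familyExponent J j) (1 : ℂ)) := by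
  rw [specialFibreIdeal, Ideal.map_span, ← Set.range_comp]
  congr 2
  exact funext (toFamily_partMonomial J)

theorem mem_support_X_mul_toFamily {f : Δ.CoxRing} {e : Option Δ.Ray →₀ ℕ} :
    e ∈ (MvPolynomial.X none * toFamily f).support ↔
      ∃ d ∈ f.support, e = Finsupp.single none 1 + d.mapDomain some := by
  classical
  rw [MvPolynomial.support_X_mul, toFamily,
    MvPolynomial.support_rename_of_injective (Option.some_injective _)]
  simp [eq_comm]

/-- The Cox exponent at `r` is ⟨m, r⟩ plus the divisor coefficient, so a tight ray in part `k` is a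
variable of m_k missing from the monomial. With the converse below, the monomials of g_j correspond
to the general points. -/
theorem exists_generalPoint_of_mem_support {J : Δ.Ray → Fin c} {j : Fin c} {f : Δ.CoxRing}
    (hf : IsGeneralSection J j f) {e : Δ.Ray →₀ ℕ} (he : e ∈ f.support) :
    ∃ m ∈ generalPoints J j, ∀ r, (e r : ℤ) = m ⬝ᵥ r.gen + partDivisor J j r := by
  obtain ⟨⟨m, hm⟩, hI⟩ := (hf e).1 he
  refine ⟨m, ⟨fun r => ?_, fun k => ?_⟩, hm⟩
  · have := hm r
    have h0 : (0 : ℤ) ≤ e r := Int.natCast_nonneg _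
    linarith
  · by_contra! h
    refine hI ((monomial_mem_specialFibreIdeal_iff J e).2
      ⟨k, (partExponent_le_iff J k e).2 fun r hr => ?_⟩)
    have h1 := hm r
    have h2 := h r hr
    omega

theorem exists_mem_support_of_generalPoint {J : Δ.Ray → Fin c} {j : Fin c} {f : Δ.CoxRing}
    (hf : IsGeneralSection J j f) {m : Fin n → ℤ} (hm : m ∈ generalPoints J j) :
    ∃ e ∈ f.support, ∀ r, (e r : ℤ) = m ⬝ᵥ r.gen + partDivisor J j r := by
  have hnn : ∀ r, 0 ≤ m ⬝ᵥ r.gen + partDivisor J j r := fun r => by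
    have := hm.1 r; linarith
  set e : Δ.Ray →₀ ℕ :=
    Finsupp.equivFunOnFinite.symm fun r => (m ⬝ᵥ r.gen + partDivisor J j r).toNat with he
  have her : ∀ r, (e r : ℤ) = m ⬝ᵥ r.gen + partDivisor J j r := fun r =>
    Int.toNat_of_nonneg (hnn r)
  refine ⟨e, (hf e).2 ⟨⟨m, her⟩, fun hI => ?_⟩, her⟩
  obtain ⟨k, hk⟩ := (monomial_mem_specialFibreIdeal_iff J e).1 hI
  obtain ⟨r, hr, hmr⟩ := hm.2 k
  have h1 := (partExponent_le_iff J k e).1 hk r hr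
  have h2 := her r
  omega

/-- The weight of a Cox monomial of degree `[E_j]`. -/
theorem sum_mul_eq_of_degree {J : Δ.Ray → Fin c} {j : Fin c} {e : Δ.Ray →₀ ℕ} {m : Fin n → ℤ}
    (he : ∀ r, (e r : ℤ) = m ⬝ᵥ r.gen + partDivisor J j r) (ν : Δ.Ray → ℝ) :
    ∑ r, (e r : ℝ) * ν r = realVec m ⬝ᵥ (∑ r, ν r • Δ.rayVec r)
      + ∑ r, (partExponent J j r : ℝ) * ν r := by
  rw [dotProduct_sum_smul_rayVec, ← Finset.sum_add_distrib]
  refine Finset.sum_congr rfl fun r _ => ?_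
  have h : (e r : ℝ) = ((m ⬝ᵥ r.gen : ℤ) : ℝ) + (partDivisor J j r : ℝ) := by
    exact_mod_cast he r
  rw [h, realVec_dotProduct_rayVec, partExponent_apply, partDivisor_cast]
  push_cast
  ring

theorem sum_mapDomain_some (e : Δ.Ray →₀ ℕ) (w : Option Δ.Ray → ℝ) :
    ((e.mapDomain some).sum fun i k => (k : ℝ) * w i) = ∑ r, (e r : ℝ) * w (some r) := by
  rw [Finsupp.sum_mapDomain_index (by simp) (by intros; push_cast; ring),
    Finsupp.sum_fintype _ _ (by simp)]

theorem sum_single_add_mapDomain (e : Δ.Ray →₀ ℕ) (w : Option Δ.Ray → ℝ) :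
    ((Finsupp.single none 1 + e.mapDomain some).sum fun i k => (k : ℝ) * w i)
      = w none + ∑ r, (e r : ℝ) * w (some r) := by
  rw [Finsupp.sum_add_index' (by simp) (by intros; push_cast; ring), sum_mapDomain_some,
    Finsupp.sum_single_index (by simp)]
  simp

theorem isStandard_X_mul_toFamily {J : Δ.Ray → Fin c} {j : Fin c} {f : Δ.CoxRing}
    (hf : IsGeneralSection J j f) :
    IsStandard (familyExponent J) (MvPolynomial.X none * toFamily f) := by
  intro e he i hle
  obtain ⟨d, hd, rfl⟩ := mem_support_X_mul_toFamily.1 he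
  refine ((hf d).1 hd).2 ((monomial_mem_specialFibreIdeal_iff J d).2 ⟨i, fun r => ?_⟩)
  have := hle (some r)
  simpa [familyExponent, mapDomain_some_some] using this

theorem isClosed_specialCone (J : Δ.Ray → Fin c) : IsClosed (specialCone J) := by
  have : specialCone J = ⋂ j, ⋂ m ∈ generalPoints J j,
      {u : ℝ × (Fin n → ℝ) | 0 ≤ u.1 + realVec m ⬝ᵥ u.2} := by
    ext; simp [specialCone]
  rw [this]
  refine isClosed_iInter fun j => isClosed_iInter fun m => isClosed_iInter fun _ => ?_
  refine isClosed_le continuous_const (continuous_fst.add ?_)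
  simp only [dotProduct_comm (realVec m)]
  exact (continuous_dotProduct_right _).comp continuous_snd

/-- After the sign change, the weight of a term of t g_j exceeds that of m_j by u_t + ⟨m, u_x⟩. Lead
ideal I_0 forces this to be non-negative, while strict positivity gives lead ideal I_0 whatever the
refining order is. -/
theorem IsNefPartition.groebnerCone_eq {J : Δ.Ray → Fin c} (hJ : IsNefPartition J)
    {g : Fin c → Δ.CoxRing} (hg : ∀ j, IsGeneralSection J j (g j))
    {lt : (Option Δ.Ray →₀ ℕ) → (Option Δ.Ray →₀ ℕ) → Prop} (hlt : IsMonomialOrdering lt) :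
    groebnerCone lt (specialFibreIdeal J) (degenerationIdeal J g) = specialCone J := by
  have hcop := coprimeExponents_familyExponent J
  refine Set.Subset.antisymm (closure_minimal ?_ (isClosed_specialCone J)) ?_
  · rintro u ⟨w, rfl, hw⟩ j m hm
    rw [map_specialFibreIdeal, degenerationIdeal_eq] at hw
    obtain ⟨e, he, hem⟩ := exists_mem_support_of_generalPoint (hg j) hm
    have h := hcop.lt_of_leadIdeal_eq (fun j => toFamily (g j))
      (weightOrdering_isMonomialOrdering hlt w) (fun j => isStandard_X_mul_toFamily (hg j)) hw j _
      (mem_support_X_mul_toFamily.2 ⟨e, he, rfl⟩)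
    have hle : w none + ∑ r, (e r : ℝ) * w (some r)
        ≤ ∑ r, (partExponent J j r : ℝ) * w (some r) := by
      rw [← sum_single_add_mapDomain, ← sum_mapDomain_some]
      rcases h with h | h
      exacts [h.le, h.1.le]
    rw [sum_mul_eq_of_degree hem fun r => w (some r)] at hle
    have e1 : (-weightProj w).1 = -w none := rfl
    have e2 : (-weightProj w).2 = -∑ r, w (some r) • Δ.rayVec r := rfl
    rw [e1, e2, dotProduct_neg]
    linarith
  · intro u hu
    have hstrict : ∀ v : ℝ × (Fin n → ℝ),
        (∀ j, ∀ m ∈ generalPoints J j, 0 < v.1 + realVec m ⬝ᵥ v.2) →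
        v ∈ {u | ∃ w : Option Δ.Ray → ℝ, u = -weightProj w ∧
          leadIdeal (weightOrdering w lt) (degenerationIdeal J g) =
            (specialFibreIdeal J).map (toFamily : Δ.CoxRing →ₐ[ℂ] Δ.FamilyRing)} := by
      intro v hv
      obtain ⟨a, -, hav, -⟩ := hJ.exists_combination (-v.2)
      refine ⟨fun i => i.elim (-v.1) a, ?_, ?_⟩
      · refine Prod.ext ?_ ?_
        · change v.1 = - -v.1
          rw [neg_neg]
        · change v.2 = -∑ r, a r • Δ.rayVec r
          rw [hav, neg_neg]
      · rw [map_specialFibreIdeal, degenerationIdeal_eq]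
        refine hcop.leadIdeal_eq _ (weightOrdering_isMonomialOrdering hlt _) fun j e he => ?_
        obtain ⟨d, hd, rfl⟩ := mem_support_X_mul_toFamily.1 he
        obtain ⟨m, hm, hdm⟩ := exists_generalPoint_of_mem_support (hg j) hd
        left
        rw [sum_single_add_mapDomain, familyExponent, sum_mapDomain_some]
        simp only [Option.elim]
        rw [sum_mul_eq_of_degree hdm a, hav, dotProduct_neg]
        have := hv j m hm
        linarith
    -- Raising the `t`-coordinate makes all the inequalities strict at once.
    have hlim : Filter.Tendsto (fun s : ℝ => (u.1 + s, u.2)) (nhdsWithin 0 (Set.Ioi 0))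
        (nhds u) := by
      have hc : Continuous fun s : ℝ => (u.1 + s, u.2) := by fun_prop
      have := hc.tendsto 0
      simp only [add_zero] at this
      exact this.mono_left nhdsWithin_le_nhds
    refine mem_closure_of_tendsto hlim ?_
    filter_upwards [self_mem_nhdsWithin] with s hs
    refine hstrict _ fun j m hm => ?_
    have h1 := hu j m hm
    have h2 : 0 < s := hs
    simp only
    linarith

end ReflexivePolytope

/-! ### Zeros of the degeneration over Hahn series. -/

theorem MvPolynomial.exists_eval_ne_zero_of_ne_zero {σ K : Type*} [Field K] [Infinite K]
    {f : MvPolynomial σ K} (hf : f ≠ 0) : ∃ x, eval x f ≠ 0 := by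
  by_contra! h
  exact hf (funext fun x => by rw [h x, map_zero])

namespace HahnSeries

theorem algebraMap_eq_C (x : ℂ) : algebraMap ℂ (HahnSeries ℝ ℂ) x = C x := by
  rw [algebraMap_apply', PowerSeries.algebraMap_apply, ofPowerSeries_C]
  rfl

theorem prod_single_mul_pow {ι : Type*} [Fintype ι] (ν : ι → ℝ) (y : ι → HahnSeries ℝ ℂ)
    (e : ι → ℕ) : ∏ r, (single (ν r) 1 * y r) ^ e r
      = single (∑ r, (e r : ℝ) * ν r) 1 * ∏ r, y r ^ e r := by
  simp only [mul_pow, Finset.prod_mul_distrib, single_pow, one_pow, nsmul_eq_mul]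
  congr 1
  induction (Finset.univ : Finset ι) using Finset.cons_induction with
  | empty => simp
  | cons a s ha ih => rw [Finset.prod_cons, Finset.sum_cons, ih, single_mul_single, one_mul]

theorem order_prod_pow {ι : Type*} [Fintype ι] {x : ι → HahnSeries ℝ ℂ} (hx : ∀ r, x r ≠ 0)
    (e : ι → ℕ) : (∏ r, x r ^ e r).order = ∑ r, (e r : ℝ) * (x r).order := by
  induction (Finset.univ : Finset ι) using Finset.cons_induction with
  | empty => simp
  | cons a s ha ih =>
    rw [Finset.prod_cons, Finset.sum_cons, order_mul (pow_ne_zero _ (hx a))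
      (Finset.prod_ne_zero_iff.2 fun r _ => pow_ne_zero _ (hx r)), ih, order_pow, nsmul_eq_mul]

theorem ne_zero_and_order_eq_zero {x : HahnSeries ℝ ℂ} {α : ℂ} (hα : α ≠ 0)
    (h : 0 < (x - C α).orderTop) : x ≠ 0 ∧ x.order = 0 := by
  have hC : (C (Γ := ℝ) α).orderTop = 0 := by
    rw [C_apply, orderTop_single hα]; rfl
  have hx : x.orderTop = 0 := by
    have := orderTop_add_eq_left (x := C (Γ := ℝ) α) (y := x - C α) (by rwa [hC])
    rwa [add_sub_cancel, hC] at this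
  have hx0 : x ≠ 0 := by rintro rfl; simp at hx
  refine ⟨hx0, ?_⟩
  rw [← order_eq_orderTop_of_ne_zero hx0] at hx
  exact_mod_cast hx

end HahnSeries

namespace ReflexivePolytope

variable {n : ℕ} {Δ : ReflexivePolytope n} {c : ℕ}

theorem aeval_toFamily (p : Option Δ.Ray → HahnSeries ℝ ℂ) (f : Δ.CoxRing) :
    MvPolynomial.aeval p (toFamily f)
      = ∑ e ∈ f.support, HahnSeries.C (f.coeff e) * ∏ r, p (some r) ^ e r := by
  rw [toFamily, MvPolynomial.aeval_rename, MvPolynomial.aeval_def, MvPolynomial.eval₂_eq']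
  simp only [HahnSeries.algebraMap_eq_C, Function.comp_apply]

theorem aeval_partMonomial (p : Option Δ.Ray → HahnSeries ℝ ℂ) (J : Δ.Ray → Fin c)
    (j : Fin c) : MvPolynomial.aeval p (toFamily (partMonomial J j))
      = ∏ r, p (some r) ^ partExponent J j r := by
  rw [partMonomial_eq, toFamily, MvPolynomial.aeval_rename, MvPolynomial.aeval_monomial,
    map_one, one_mul, Finsupp.prod_fintype _ _ (by simp)]
  rfl

theorem forall_mem_degenerationIdeal_iff (J : Δ.Ray → Fin c) (g : Fin c → Δ.CoxRing)
    (p : Option Δ.Ray → HahnSeries ℝ ℂ) :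
    (∀ f ∈ degenerationIdeal J g, MvPolynomial.aeval p f = 0) ↔
      ∀ j, p none * (∑ e ∈ (g j).support, HahnSeries.C ((g j).coeff e) * ∏ r, p (some r) ^ e r)
        + ∏ r, p (some r) ^ partExponent J j r = 0 := by
  have : (∀ f ∈ degenerationIdeal J g, MvPolynomial.aeval p f = 0) ↔
      degenerationIdeal J g ≤ RingHom.ker (MvPolynomial.aeval (R := ℂ) p) := Iff.rfl
  rw [this, degenerationIdeal, Ideal.span_le, Set.range_subset_iff]
  refine forall_congr' fun j => ?_
  rw [SetLike.mem_coe, RingHom.mem_ker, map_add, map_mul, MvPolynomial.aeval_X, aeval_toFamily,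
    aeval_partMonomial]

/-- The weight of a zero is not attained by the monomial `m_j` alone. -/
theorem exists_generalPoint_of_mem_bergmanFan {J : Δ.Ray → Fin c} {g : Fin c → Δ.CoxRing}
    (hg : ∀ j, IsGeneralSection J j (g j)) {u : ℝ × (Fin n → ℝ)}
    (hu : u ∈ bergmanFan (degenerationIdeal J g)) (j : Fin c) :
    ∃ m ∈ generalPoints J j, u.1 + realVec m ⬝ᵥ u.2 ≤ 0 := by
  by_contra! h
  obtain ⟨p, hp0, hp, rfl⟩ := hu
  have hj := (forall_mem_degenerationIdeal_iff J g p).1 hp j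
  have hpart : ∏ r, p (some r) ^ partExponent J j r ≠ 0 :=
    Finset.prod_ne_zero_iff.2 fun r _ => pow_ne_zero _ (hp0 _)
  have hval : HahnSeries.addVal ℝ ℂ (∏ r, p (some r) ^ partExponent J j r)
      = ((∑ r, (partExponent J j r : ℝ) * (p (some r)).order : ℝ) : WithTop ℝ) := by
    rw [HahnSeries.addVal_apply_of_ne hpart, HahnSeries.order_prod_pow fun r => hp0 (some r)]
  rw [Finset.mul_sum] at hj
  have hlt : HahnSeries.addVal ℝ ℂ (∏ r, p (some r) ^ partExponent J j r) <
      HahnSeries.addVal ℝ ℂ (∑ e ∈ (g j).support,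
        p none * (HahnSeries.C ((g j).coeff e) * ∏ r, p (some r) ^ e r)) := by
    refine AddValuation.map_lt_sum _ (by rw [hval]; exact WithTop.coe_ne_top) fun e he => ?_
    have hC : HahnSeries.C (Γ := ℝ) ((g j).coeff e) ≠ 0 := by
      rw [HahnSeries.C_apply]; exact HahnSeries.single_ne_zero (MvPolynomial.mem_support_iff.1 he)
    have hprod : ∏ r, p (some r) ^ e r ≠ 0 :=
      Finset.prod_ne_zero_iff.2 fun r _ => pow_ne_zero _ (hp0 _)
    rw [hval, HahnSeries.addVal_apply_of_ne (mul_ne_zero (hp0 none) (mul_ne_zero hC hprod)),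
      HahnSeries.order_mul (hp0 none) (mul_ne_zero hC hprod), HahnSeries.order_mul hC hprod,
      HahnSeries.order_C, zero_add, HahnSeries.order_prod_pow fun r => hp0 (some r),
      WithTop.coe_lt_coe]
    obtain ⟨m, hm, hem⟩ := exists_generalPoint_of_mem_support (hg j) he
    rw [sum_mul_eq_of_degree hem]
    have h1 : 0 < (p none).order
        + realVec m ⬝ᵥ (∑ r, (p (some r)).order • Δ.rayVec r) := h m hm
    linarith
  rw [eq_neg_of_add_eq_zero_left hj, AddValuation.map_neg] at hlt
  exact lt_irrefl _ hlt

/-- If the initial forms at `u` are linear in one variable of each part, then they lift to a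
zero. -/
theorem IsNefPartition.mem_bergmanFan {J : Δ.Ray → Fin c} (hJ : IsNefPartition J)
    {g : Fin c → Δ.CoxRing} (hg : ∀ j, IsGeneralSection J j (g j)) {u : ℝ × (Fin n → ℝ)}
    (hu : u ∈ specialCone J) (ρ : Fin c → Δ.Ray) (hρ : ∀ j, J (ρ j) = j)
    (hex : ∀ j, ∃ m ∈ generalPoints J j, u.1 + realVec m ⬝ᵥ u.2 = 0)
    (hface : ∀ j, ∀ m ∈ generalPoints J j, u.1 + realVec m ⬝ᵥ u.2 = 0 →
      ∀ k, m ⬝ᵥ (ρ k).gen = -partDivisor J j (ρ k)) :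
    u ∈ bergmanFan (degenerationIdeal J g) := by
  classical
  obtain ⟨ν, -, hν, -⟩ := hJ.exists_combination u.2
  set S : Fin c → ℝ := fun j => ∑ r, (partExponent J j r : ℝ) * ν r with hS
  -- `wt j e` is the excess of the weight of the term `e` of t g_j over that of m_j.
  set wt : Fin c → (Δ.Ray →₀ ℕ) → ℝ := fun j e => u.1 + ∑ r, (e r : ℝ) * ν r - S j with hwt
  have hwt_eq : ∀ j (e : Δ.Ray →₀ ℕ) (m : Fin n → ℤ),
      (∀ r, (e r : ℤ) = m ⬝ᵥ r.gen + partDivisor J j r) →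
      wt j e = u.1 + realVec m ⬝ᵥ u.2 := by
    intro j e m h
    simp only [hwt]
    rw [sum_mul_eq_of_degree h ν, hν]; ring
  have hwt_nonneg : ∀ j, ∀ e ∈ (g j).support, 0 ≤ wt j e := by
    intro j e he
    obtain ⟨m, hm, hem⟩ := exists_generalPoint_of_mem_support (hg j) he
    rw [hwt_eq j e m hem]; exact hu j m hm
  have hwt_zero : ∀ j, ∀ e ∈ (g j).support, wt j e = 0 → ∀ k, e (ρ k) = 0 := by
    intro j e he h0 k
    obtain ⟨m, hm, hem⟩ := exists_generalPoint_of_mem_support (hg j) he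
    rw [hwt_eq j e m hem] at h0
    have h1 := hface j m hm h0 k
    have h2 := hem (ρ k)
    omega
  -- `Q j` collects the terms of excess zero; by `hwt_zero` it involves none of the variables `ρ k`.
  set Q : Fin c → Δ.CoxRing := fun j =>
    ∑ e ∈ (g j).support with wt j e = 0, MvPolynomial.monomial e ((g j).coeff e) with hQ
  have hQ0 : ∀ j, Q j ≠ 0 := by
    intro j h0
    obtain ⟨m, hm, hmu⟩ := hex j
    obtain ⟨e, he, hem⟩ := exists_mem_support_of_generalPoint (hg j) hm
    have h1 := congrArg (MvPolynomial.coeff e) h0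
    rw [hQ] at h1
    simp only [MvPolynomial.coeff_sum, MvPolynomial.coeff_monomial, MvPolynomial.coeff_zero] at h1
    rw [Finset.sum_ite_eq', if_pos (Finset.mem_filter.2 ⟨he, by rw [hwt_eq j e m hem, hmu]⟩)] at h1
    exact MvPolynomial.mem_support_iff.1 he h1
  -- `b` must avoid the zeros of every `Q j`, since the leading coefficient of `l j` will be `-Q j
  -- (b) / B j`.
  obtain ⟨b, hb⟩ := MvPolynomial.exists_eval_ne_zero_of_ne_zero
    (f := (∏ j, Q j) * ∏ r : Δ.Ray, MvPolynomial.X r)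
    (mul_ne_zero (Finset.prod_ne_zero_iff.2 fun j _ => hQ0 j)
      (Finset.prod_ne_zero_iff.2 fun r _ => MvPolynomial.X_ne_zero r))
  rw [map_mul, map_prod, map_prod] at hb
  have hbQ : ∀ j, MvPolynomial.eval b (Q j) ≠ 0 := fun j =>
    Finset.prod_ne_zero_iff.1 (left_ne_zero_of_mul hb) j (Finset.mem_univ j)
  have hb0 : ∀ r, b r ≠ 0 := fun r => by
    have := Finset.prod_ne_zero_iff.1 (right_ne_zero_of_mul hb) r (Finset.mem_univ r)
    rwa [MvPolynomial.eval_X] at this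
  set B : Fin c → ℂ := fun j => ∏ r, b r ^ partExponent J j r with hB
  have hB0 : ∀ j, B j ≠ 0 := fun j =>
    Finset.prod_ne_zero_iff.2 fun r _ => pow_ne_zero _ (hb0 r)
  set κ : Fin c → (Δ.Ray →₀ ℕ) → ℂ := fun j e => (g j).coeff e * ∏ r, b r ^ e r with hκ
  have hevalQ : ∀ j, MvPolynomial.eval b (Q j)
      = ∑ e ∈ (g j).support with wt j e = 0, κ j e := by
    intro j
    rw [hQ, map_sum]
    refine Finset.sum_congr rfl fun e _ => ?_
    rw [MvPolynomial.eval_monomial, Finsupp.prod_fintype _ _ (by simp)]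
  -- Ansatz x_r = s^(ν r) · b r · z r, with z r the unknown `l j` at `r = ρ j` and 1 elsewhere. The
  -- terms of positive excess form the perturbation `P`.
  set Z : Δ.Ray → MvPolynomial (Fin c) ℂ := fun r =>
    if r = ρ (J r) then MvPolynomial.X (J r) else 1 with hZ
  set P : Fin c → MvPolynomial (Fin c) (HahnSeries ℝ ℂ) := fun j =>
    ∑ e ∈ (g j).support with wt j e ≠ 0,
      MvPolynomial.C (HahnSeries.single (wt j e) (-(B j)⁻¹ * κ j e)) *
        MvPolynomial.map HahnSeries.C (∏ r, Z r ^ e r) with hP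
  have hPpos : ∀ j d, 0 < ((P j).coeff d).orderTop := by
    intro j d
    rw [hP]
    simp only [MvPolynomial.coeff_sum, MvPolynomial.coeff_C_mul, MvPolynomial.coeff_map]
    simp only [← HahnSeries.addVal_apply]
    refine AddValuation.map_lt_sum _ (by simp) fun e he => ?_
    obtain ⟨he, hne⟩ := Finset.mem_filter.1 he
    rw [HahnSeries.addVal_apply, HahnSeries.C_apply, HahnSeries.single_mul_single, add_zero]
    refine lt_of_lt_of_le ?_ HahnSeries.orderTop_single_le
    exact_mod_cast lt_of_le_of_ne (hwt_nonneg j e he) (Ne.symm hne)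
  obtain ⟨l, hl⟩ := HahnSeries.exists_fixedPoint
    (fun j => -(B j)⁻¹ * MvPolynomial.eval b (Q j)) P hPpos
  have hl0 : ∀ j, l j ≠ 0 ∧ (l j).order = 0 := fun j =>
    HahnSeries.ne_zero_and_order_eq_zero
      (mul_ne_zero (neg_ne_zero.2 (inv_ne_zero (hB0 j))) (hbQ j)) (hl j).2
  set z : Δ.Ray → HahnSeries ℝ ℂ := fun r => if r = ρ (J r) then l (J r) else 1 with hz
  have hz0 : ∀ r, z r ≠ 0 ∧ (z r).order = 0 := by
    intro r
    simp only [hz]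
    split_ifs
    exacts [hl0 _, ⟨one_ne_zero, HahnSeries.order_one⟩]
  have hZz : ∀ e : Δ.Ray →₀ ℕ, MvPolynomial.eval l (MvPolynomial.map HahnSeries.C (∏ r, Z r ^ e r))
      = ∏ r, z r ^ e r := by
    intro e
    rw [map_prod, map_prod]
    refine Finset.prod_congr rfl fun r _ => ?_
    rw [map_pow, map_pow]
    congr 1
    simp only [hZ, hz]
    split_ifs <;> simp
  have hCb : ∀ e : Δ.Ray → ℕ, ∏ r, (z r * HahnSeries.C (b r)) ^ e r
      = HahnSeries.C (∏ r, b r ^ e r) * ∏ r, z r ^ e r := by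
    intro e
    simp only [mul_pow, Finset.prod_mul_distrib, map_prod, map_pow]
    rw [mul_comm]
  have hCb0 : ∀ r, HahnSeries.C (Γ := ℝ) (b r) ≠ 0 := fun r => by
    rw [HahnSeries.C_apply]; exact HahnSeries.single_ne_zero (hb0 r)
  have hs1 : ∀ x : ℝ, HahnSeries.single x (1 : ℂ) ≠ 0 := fun x =>
    HahnSeries.single_ne_zero one_ne_zero
  -- This is the `j`-th equation divided by s^(S j); m_j contributes the term linear in `l j`.
  have hsystem : ∀ j, HahnSeries.C (B j) * l j
      + ∑ e ∈ (g j).support, HahnSeries.single (wt j e) (κ j e) * ∏ r, z r ^ e r = 0 := by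
    intro j
    rw [← Finset.sum_filter_add_sum_filter_not _ (fun e => wt j e = 0)]
    have e1 : ∑ e ∈ (g j).support with wt j e = 0,
        HahnSeries.single (wt j e) (κ j e) * ∏ r, z r ^ e r
        = HahnSeries.C (MvPolynomial.eval b (Q j)) := by
      rw [hevalQ, map_sum]
      refine Finset.sum_congr rfl fun e he => ?_
      obtain ⟨he, h0⟩ := Finset.mem_filter.1 he
      rw [h0, Finset.prod_eq_one, mul_one, HahnSeries.C_apply]
      intro r _
      simp only [hz]
      split_ifs with h
      · rw [h, hwt_zero j e he h0 (J r), pow_zero]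
      · exact one_pow _
    have e2 : HahnSeries.C (B j) * MvPolynomial.eval l (P j)
        = -∑ e ∈ (g j).support with ¬ wt j e = 0,
          HahnSeries.single (wt j e) (κ j e) * ∏ r, z r ^ e r := by
      rw [hP, map_sum, Finset.mul_sum, ← Finset.sum_neg_distrib]
      refine Finset.sum_congr rfl fun e _ => ?_
      rw [map_mul, MvPolynomial.eval_C, hZz, ← mul_assoc, HahnSeries.C_apply,
        HahnSeries.single_mul_single, zero_add]
      have : B j * (-(B j)⁻¹ * κ j e) = -κ j e := by
        rw [← mul_assoc, mul_neg, mul_inv_cancel₀ (hB0 j), neg_one_mul]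
      rw [this, HahnSeries.single_neg, neg_mul]
    have e3 : HahnSeries.C (Γ := ℝ) (B j) * HahnSeries.C (-(B j)⁻¹ * MvPolynomial.eval b (Q j))
        = -HahnSeries.C (MvPolynomial.eval b (Q j)) := by
      rw [← map_mul, ← map_neg, ← mul_assoc, mul_neg, mul_inv_cancel₀ (hB0 j), neg_one_mul]
    rw [(hl j).1, mul_add, e1, e2, e3]
    ring
  refine ⟨fun i => i.elim (HahnSeries.single u.1 1)
    fun r => HahnSeries.single (ν r) 1 * (z r * HahnSeries.C (b r)), ?_, ?_, ?_⟩
  · rintro (_ | r)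
    exacts [hs1 _, mul_ne_zero (hs1 _) (mul_ne_zero (hz0 r).1 (hCb0 r))]
  · rw [forall_mem_degenerationIdeal_iff]
    intro j
    simp only [Option.elim]
    simp only [HahnSeries.prod_single_mul_pow, hCb]
    have e1 : ∏ r, z r ^ partExponent J j r = l j := by
      rw [Finset.prod_eq_single (ρ j)]
      · simp [hz, hρ, partExponent_apply]
      · intro r _ hr
        simp only [hz, partExponent_apply]
        by_cases hJr : J r = j
        · rw [if_neg (by rw [hJr]; exact hr), one_pow]
        · rw [if_neg hJr, pow_zero]
      · intro h; exact absurd (Finset.mem_univ _) h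
    have e2 : HahnSeries.single u.1 (1 : ℂ) * (∑ e ∈ (g j).support,
        HahnSeries.C ((g j).coeff e) * (HahnSeries.single (∑ r, (e r : ℝ) * ν r) 1 *
          (HahnSeries.C (∏ r, b r ^ e r) * ∏ r, z r ^ e r)))
        = HahnSeries.single (S j) 1 *
          ∑ e ∈ (g j).support, HahnSeries.single (wt j e) (κ j e) * ∏ r, z r ^ e r := by
      rw [Finset.mul_sum, Finset.mul_sum]
      refine Finset.sum_congr rfl fun e _ => ?_
      rw [← mul_assoc (HahnSeries.single (S j) (1 : ℂ)), HahnSeries.single_mul_single, one_mul]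
      have : HahnSeries.single (S j + wt j e) (κ j e)
          = HahnSeries.single u.1 (1 : ℂ) * (HahnSeries.C ((g j).coeff e) *
            (HahnSeries.single (∑ r, (e r : ℝ) * ν r) 1 * HahnSeries.C (∏ r, b r ^ e r))) := by
        simp only [HahnSeries.C_apply, HahnSeries.single_mul_single, hwt, hκ, one_mul, zero_add,
          add_zero, add_sub_cancel]
      rw [this]
      ring
    rw [e1, e2]
    have := congrArg (fun x => HahnSeries.single (S j) (1 : ℂ) * x) (hsystem j)
    simp only [mul_add, mul_zero] at this
    rw [add_comm]
    exact this
  · refine Prod.ext ?_ ?_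
    · exact (HahnSeries.order_single one_ne_zero).symm
    · change u.2 = ∑ r, (HahnSeries.single (ν r) (1 : ℂ) * (z r * HahnSeries.C (b r))).order •
        Δ.rayVec r
      rw [← hν]
      refine Finset.sum_congr rfl fun r _ => ?_
      rw [HahnSeries.order_mul (hs1 _) (mul_ne_zero (hz0 r).1 (hCb0 r)),
        HahnSeries.order_mul (hz0 r).1 (hCb0 r), (hz0 r).2, HahnSeries.order_C,
        HahnSeries.order_single one_ne_zero, add_zero, add_zero]

/-- By the Nullstellensatz, an ideal with a zero in the torus over the field of series has one over
the complex numbers. -/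
theorem zero_mem_bergmanFan {I : Ideal Δ.FamilyRing} {u : ℝ × (Fin n → ℝ)}
    (hu : u ∈ bergmanFan I) : (0 : ℝ × (Fin n → ℝ)) ∈ bergmanFan I := by
  obtain ⟨p, hp0, hp, -⟩ := hu
  have hex : ∃ x ∈ MvPolynomial.zeroLocus ℂ I, ∀ i, x i ≠ 0 := by
    by_contra! h
    have hmem : (∏ i : Option Δ.Ray, MvPolynomial.X i : Δ.FamilyRing) ∈
        MvPolynomial.vanishingIdeal ℂ (MvPolynomial.zeroLocus ℂ I) := by
      intro x hx
      obtain ⟨i, hi⟩ := h x hx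
      rw [map_prod]
      exact Finset.prod_eq_zero (Finset.mem_univ i) (by rw [MvPolynomial.aeval_X, hi])
    rw [MvPolynomial.vanishingIdeal_zeroLocus_eq_radical] at hmem
    obtain ⟨k, hk⟩ := hmem
    have h0 := hp _ hk
    rw [map_pow, map_prod] at h0
    simp only [MvPolynomial.aeval_X] at h0
    exact pow_ne_zero k (Finset.prod_ne_zero_iff.2 fun i _ => hp0 i) h0
  obtain ⟨x, hx, hx0⟩ := hex
  refine ⟨fun i => HahnSeries.C (x i), fun i => ?_, fun f hf => ?_, ?_⟩
  · exact HahnSeries.single_ne_zero (hx0 i)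
  · have h1 : MvPolynomial.aeval (fun i => HahnSeries.C (Γ := ℝ) (x i)) f
        = HahnSeries.C (MvPolynomial.aeval x f) := by
      rw [MvPolynomial.map_aeval, MvPolynomial.aeval_def, MvPolynomial.coe_eval₂Hom]
      congr 1
      exact RingHom.ext HahnSeries.algebraMap_eq_C
    rw [h1, hx f hf, map_zero]
  · simp only [weightProj, HahnSeries.order_C, zero_smul, Finset.sum_const_zero]
    rfl

/-! ### Faces of the cone and the Bergman fan. -/

theorem specialCone_add_smul_mem {J : Δ.Ray → Fin c} {u v : ℝ × (Fin n → ℝ)}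
    (hu : u ∈ specialCone J) (hv : v ∈ specialCone J) {s : ℝ} (hs : 0 ≤ s) :
    u + s • v ∈ specialCone J := by
  intro j m hm
  have h1 := hu j m hm
  have h2 := mul_nonneg hs (hv j m hm)
  simp only [Prod.fst_add, Prod.snd_add, Prod.smul_fst, Prod.smul_snd, dotProduct_add,
    dotProduct_smul, smul_eq_mul]
  linarith

theorem convex_specialCone (J : Δ.Ray → Fin c) : Convex ℝ (specialCone J) := by
  intro u hu v hv a b ha hb _ j m hm
  have h1 := mul_nonneg ha (hu j m hm)
  have h2 := mul_nonneg hb (hv j m hm)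
  simp only [Prod.fst_add, Prod.snd_add, Prod.smul_fst, Prod.smul_snd, dotProduct_add,
    dotProduct_smul, smul_eq_mul]
  linarith

/-- The slice at height one of a tropical face. -/
theorem isTropicalSlice_of_subset_bergmanFan {J : Δ.Ray → Fin c} {g : Fin c → Δ.CoxRing}
    (hg : ∀ j, IsGeneralSection J j (g j)) {C : Set (ℝ × (Fin n → ℝ))}
    (hC : IsExposed ℝ (specialCone J) C) (hBF : C ⊆ bergmanFan (degenerationIdeal J g))
    (hne : {w | ((1 : ℝ), w) ∈ C}.Nonempty) : IsTropicalSlice J {w | ((1 : ℝ), w) ∈ C} := by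
  have hconv : Convex ℝ {w | ((1 : ℝ), w) ∈ C} := by
    intro x hx y hy a b ha hb hab
    have := hC.convex (convex_specialCone J) hx hy ha hb hab
    simpa [hab] using this
  have hsub : ∀ w ∈ {w | ((1 : ℝ), w) ∈ C}, ((1 : ℝ), w) ∈ specialCone J := fun w hw =>
    hC.subset hw
  refine ⟨hconv, hne, hsub, fun j => ?_⟩
  have hge : ∀ m ∈ generalPoints J j, ∀ w ∈ {w | ((1 : ℝ), w) ∈ C}, -1 ≤ realVec m ⬝ᵥ w :=
    fun m hm w hw => by
      have h : 0 ≤ (1 : ℝ) + realVec m ⬝ᵥ w := hsub w hw j m hm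
      linarith
  -- A zero of the ideal gives a tight general point over a single weight; genericity of `w₀` makes
  -- it tight on the whole slice.
  obtain ⟨w₀, hw₀, hgen⟩ := hconv.exists_generic hne (S := realVec '' generalPoints J j)
    (((finite_sectionPoints J j).subset fun m hm => hm.1).image _)
    (by rintro _ ⟨m, hm, rfl⟩; exact hge m hm)
  obtain ⟨m, hm, hle⟩ := exists_generalPoint_of_mem_bergmanFan hg (hBF hw₀) j
  simp only at hle
  exact ⟨m, hm, hgen _ ⟨m, hm, rfl⟩ (le_antisymm (by linarith) (hge m hm w₀ hw₀))⟩

/-- A slice is recovered from the face of the reflexive polytope that it corresponds to. -/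
theorem IsTropicalSlice.subset_of_subset {J : Δ.Ray → Fin c} (hJ : IsNefPartition J)
    {F : Set (Fin n → ℝ)} (hF : IsTropicalSlice J F) {C : Set (ℝ × (Fin n → ℝ))}
    (hC : IsExposed ℝ (specialCone J) C) (hCF : IsTropicalSlice J {w | ((1 : ℝ), w) ∈ C})
    (h : {x ∈ Δ.carrier | ∀ w, ((1 : ℝ), w) ∈ C → x ⬝ᵥ w = -c} ⊆
      {x ∈ Δ.carrier | ∀ w ∈ F, x ⬝ᵥ w = -c}) : F ⊆ {w | ((1 : ℝ), w) ∈ C} := by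
  classical
  intro w hw
  obtain ⟨w₀, hw₀, hgen⟩ := hCF.exists_generic hJ
  have htrop := hF.isTropicalPoint hw
  have hw₀C : ((1 : ℝ), w₀) ∈ C := hw₀
  have key : ∀ j, ∀ m ∈ generalPoints J j, realVec m ⬝ᵥ w₀ = -1 → realVec m ⬝ᵥ w = -1 := by
    intro j m hm hmw₀
    choose p hp hpC using hCF.exists_generalPoint
    -- Exchange the `j`-th summand for `m`: the sum still lies in the face for `C`, hence in the one
    -- for `F`, so each summand, `m` included, is tight at `w`.
    set q : Fin c → Fin n → ℤ := Function.update p j m with hq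
    have hqs : ∀ k, q k ∈ sectionPoints J k := by
      intro k
      by_cases hk : k = j
      · subst hk; rw [hq, Function.update_self]; exact hm.1
      · rw [hq, Function.update_of_ne hk]; exact (hp k).1
    have hqC : ∀ k, ∀ v, ((1 : ℝ), v) ∈ C → realVec (q k) ⬝ᵥ v = -1 := by
      intro k v hv
      by_cases hk : k = j
      · subst hk; rw [hq, Function.update_self]; exact hgen _ m hm.1 hmw₀ v hv
      · rw [hq, Function.update_of_ne hk]; exact hpC k v hv
    have hmem := h ⟨sum_mem_carrier (J := J) (x := fun k => realVec (q k)) fun k =>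
        subset_convexHull ℝ _ ⟨q k, hqs k, rfl⟩, fun v hv => by
      rw [sum_dotProduct, Finset.sum_congr rfl fun k _ => hqC k v hv]; simp⟩
    have hsum := hmem.2 w hw
    have hge : ∀ k ∈ Finset.univ, 0 ≤ realVec (q k) ⬝ᵥ w + 1 := fun k _ => by
      have := htrop.neg_one_le hJ (j := k) (subset_convexHull ℝ _ ⟨q k, hqs k, rfl⟩)
      linarith
    have h2 : ∑ k, (realVec (q k) ⬝ᵥ w + 1) = 0 := by
      rw [sum_dotProduct] at hsum
      rw [Finset.sum_add_distrib, hsum]; simp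
    have h3 := (Finset.sum_eq_zero_iff_of_nonneg hge).1 h2 j (Finset.mem_univ j)
    rw [hq, Function.update_self] at h3
    linarith
  -- The constraints tight at `w₀` are tight at `w` by `key` and the others have slack, so the
  -- segment from `w` to `w₀` can be prolonged inside the cone. Then `w₀` lies strictly inside a
  -- segment, and the exposed face through it contains the endpoint `w`.
  have hex : ∃ ε : ℝ, 0 < ε ∧ ((1 : ℝ), w₀ + ε • (w₀ - w)) ∈ specialCone J := by
    have hev : ∀ᶠ ε : ℝ in nhdsWithin 0 (Set.Ioi 0),
        ∀ j, ∀ m ∈ generalPoints J j, 0 ≤ 1 + realVec m ⬝ᵥ (w₀ + ε • (w₀ - w)) := by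
      rw [Filter.eventually_all]
      intro j
      have hfin : (generalPoints J j).Finite :=
        (finite_sectionPoints J j).subset fun m hm => hm.1
      rw [hfin.eventually_all]
      intro m hm
      by_cases h0 : realVec m ⬝ᵥ w₀ = -1
      · refine Filter.Eventually.of_forall fun ε => ?_
        rw [dotProduct_add, dotProduct_smul, dotProduct_sub, h0, key j m hm h0]
        simp
      · have h1 : 0 ≤ (1 : ℝ) + realVec m ⬝ᵥ w₀ := hC.subset hw₀C j m hm
        have hpos : 0 < 1 + realVec m ⬝ᵥ (w₀ + (0 : ℝ) • (w₀ - w)) := by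
          rw [zero_smul, add_zero]
          exact lt_of_le_of_ne h1 fun h => h0 (by linarith)
        have hcont : Continuous fun ε : ℝ => 1 + realVec m ⬝ᵥ (w₀ + ε • (w₀ - w)) := by
          simp only [dotProduct_add, dotProduct_smul]
          fun_prop
        have := (hcont.tendsto 0).eventually (lt_mem_nhds hpos)
        exact (this.filter_mono nhdsWithin_le_nhds).mono fun ε h => h.le
    obtain ⟨ε, hε, hεpos⟩ := (hev.and self_mem_nhdsWithin).exists
    exact ⟨ε, hεpos, hε⟩
  obtain ⟨ε, hε, hεC⟩ := hex
  obtain ⟨l, rfl⟩ := hC ⟨_, hw₀C⟩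
  refine ⟨htrop.1, fun y hy => (hw₀C.2 y hy).trans ?_⟩
  have h1 := hw₀C.2 _ hεC
  have h2 : ((1 : ℝ), w₀ + ε • (w₀ - w)) = ((1 : ℝ), w₀) + ε • (((1 : ℝ), w₀) - ((1 : ℝ), w)) := by
    ext <;> simp
  rw [h2, map_add, map_smul, map_sub, smul_eq_mul] at h1
  have h3 : ε * (l ((1 : ℝ), w₀) - l ((1 : ℝ), w)) ≤ 0 := by linarith
  have h4 := nonpos_of_mul_nonpos_right h3 hε
  linarith

/-- Scaling by `s ≠ 0`, even a negative `s`, does not change which general points are tight. They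
are all tight on the rays with `a r ≠ 0`, and one such ray per part provides the variables to solve
for. -/
theorem IsTropicalPoint.smul_mem_bergmanFan {J : Δ.Ray → Fin c} (hJ : IsNefPartition J)
    {g : Fin c → Δ.CoxRing} (hg : ∀ j, IsGeneralSection J j (g j)) {w : Fin n → ℝ}
    (hw : IsTropicalPoint J w) {s : ℝ} (hs : s ≠ 0) {v : ℝ × (Fin n → ℝ)}
    (hv : v = s • ((1 : ℝ), w)) (hvC : v ∈ specialCone J) :
    v ∈ bergmanFan (degenerationIdeal J g) := by
  obtain ⟨a, ha, hwa⟩ := hw.exists_isPartWeight hJ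
  choose ρ hρ hρa using ha.exists_ne_zero
  have hval : ∀ m : Fin n → ℤ, v.1 + realVec m ⬝ᵥ v.2 = s * (1 + realVec m ⬝ᵥ w) := by
    intro m
    rw [hv]
    simp only [Prod.smul_fst, Prod.smul_snd, dotProduct_smul, smul_eq_mul]
    ring
  refine hJ.mem_bergmanFan hg hvC ρ hρ (fun j => ?_) fun j m hm h0 k => ?_
  · obtain ⟨m, hm, hmw⟩ := hw.2 j
    exact ⟨m, hm, by rw [hval, hmw]; ring⟩
  · rw [hval] at h0
    have h1 := (mul_eq_zero.1 h0).resolve_left hs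
    rw [← realVec_dotProduct_rayVec_eq_iff]
    refine (ha.eq_neg_one_iff (subset_convexHull ℝ _ ⟨m, hm.1, rfl⟩)).1 ?_ _ (hρa k)
    rw [← hwa]
    linarith

/-- Along a cone containing `v` the minimum over Δ_j is minus the total coefficient on part `j`.
Non-negativity of these minima annihilates all the coefficients. -/
theorem IsNefPartition.eq_zero_of_nonneg {J : Δ.Ray → Fin c} (hJ : IsNefPartition J)
    {v : Fin n → ℝ} (hv : ∀ j, ∀ m ∈ sectionPoints J j, 0 ≤ realVec m ⬝ᵥ v) : v = 0 := by
  obtain ⟨a, ha, rfl, hpt⟩ := hJ.exists_combination v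
  have hle : ∀ j, ∑ r, a r * (partDivisor J j r : ℝ) ≤ 0 := fun j => by
    obtain ⟨m, hm, hmr⟩ := hpt j
    have := hv j m hm
    rw [realVec_dotProduct_combination hmr] at this
    linarith
  have hnn : ∀ j r, 0 ≤ a r * (partDivisor J j r : ℝ) := fun j r => by
    rw [partDivisor_cast]
    split_ifs
    · rw [mul_one]; exact ha r
    · rw [mul_zero]
  refine Finset.sum_eq_zero fun r _ => ?_
  have h0 := (Finset.sum_eq_zero_iff_of_nonneg fun r' _ => hnn (J r) r').1
    (le_antisymm (hle (J r)) (Finset.sum_nonneg fun r' _ => hnn (J r) r')) r (Finset.mem_univ r)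
  rw [partDivisor_cast, if_pos rfl, mul_one] at h0
  rw [h0, zero_smul]

/-- The smallest face of the cone that contains the point `w` at height one. -/
def coneFaceAt (J : Δ.Ray → Fin c) (w : Fin n → ℝ) : Set (ℝ × (Fin n → ℝ)) :=
  {v ∈ specialCone J | ∀ j, ∀ m ∈ generalPoints J j, realVec m ⬝ᵥ w = -1 →
    v.1 + realVec m ⬝ᵥ v.2 = 0}

theorem IsTropicalPoint.mem_coneFaceAt {J : Δ.Ray → Fin c} {w : Fin n → ℝ}
    (hw : IsTropicalPoint J w) : ((1 : ℝ), w) ∈ coneFaceAt J w :=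
  ⟨hw.1, fun j m _ h => by simp only; rw [h]; norm_num⟩

theorem IsTropicalPoint.of_mem_coneFaceAt {J : Δ.Ray → Fin c} {w w' : Fin n → ℝ}
    (hw : IsTropicalPoint J w) (hw' : ((1 : ℝ), w') ∈ coneFaceAt J w) : IsTropicalPoint J w' :=
  ⟨hw'.1, fun j => by
    obtain ⟨m, hm, hmw⟩ := hw.2 j
    have h : (1 : ℝ) + realVec m ⬝ᵥ w' = 0 := hw'.2 j m hm hmw
    exact ⟨m, hm, by linarith⟩⟩

theorem coneFaceAt_add_smul_mem {J : Δ.Ray → Fin c} {w : Fin n → ℝ} {u v : ℝ × (Fin n → ℝ)}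
    (hu : u ∈ coneFaceAt J w) (hv : v ∈ coneFaceAt J w) {s : ℝ} (hs : 0 ≤ s) :
    u + s • v ∈ coneFaceAt J w := by
  refine ⟨specialCone_add_smul_mem hu.1 hv.1 hs, fun j m hm hmw => ?_⟩
  have h1 := hu.2 j m hm hmw
  have h2 := hv.2 j m hm hmw
  simp only [Prod.fst_add, Prod.snd_add, Prod.smul_fst, Prod.smul_snd, dotProduct_add,
    dotProduct_smul, smul_eq_mul]
  linear_combination h1 + s * h2

theorem zero_mem_coneFaceAt (J : Δ.Ray → Fin c) (w : Fin n → ℝ) : 0 ∈ coneFaceAt J w :=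
  ⟨fun j m _ => by simp, fun j m _ _ => by simp⟩

/-- Moving from `w` along `v.2` never leaves the slice, so every section point stays bounded below
by `-1` on a whole half-line. Hence it is non-negative on `v.2`. -/
theorem IsTropicalPoint.eq_zero_of_mem_coneFaceAt {J : Δ.Ray → Fin c} (hJ : IsNefPartition J)
    {w : Fin n → ℝ} (hw : IsTropicalPoint J w) {v : ℝ × (Fin n → ℝ)} (hv : v ∈ coneFaceAt J w)
    (hv1 : v.1 = 0) : v.2 = 0 := by
  refine hJ.eq_zero_of_nonneg fun j m hm => ?_
  by_contra! hneg
  have hbound : ∀ s : ℝ, 0 ≤ s → -1 ≤ realVec m ⬝ᵥ w + s * (realVec m ⬝ᵥ v.2) := by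
    intro s hs
    have h1 := coneFaceAt_add_smul_mem hw.mem_coneFaceAt hv hs
    have h2 : ((1 : ℝ), w) + s • v = ((1 : ℝ), w + s • v.2) := by
      ext <;> simp [hv1]
    rw [h2] at h1
    have h3 := (hw.of_mem_coneFaceAt h1).neg_one_le hJ (j := j)
      (subset_convexHull ℝ _ ⟨m, hm, rfl⟩)
    rwa [dotProduct_add, dotProduct_smul, smul_eq_mul] at h3
  have hw0 := hbound 0 le_rfl
  -- At this parameter the pairing would be `-2`.
  have h := hbound ((realVec m ⬝ᵥ w + 2) / (-(realVec m ⬝ᵥ v.2)))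
    (div_nonneg (by linarith) (by linarith))
  have h2 : (realVec m ⬝ᵥ w + 2) / (-(realVec m ⬝ᵥ v.2)) * (realVec m ⬝ᵥ v.2)
      = -(realVec m ⬝ᵥ w + 2) := by
    rw [div_neg, neg_mul, div_mul_cancel₀ _ hneg.ne]
  rw [h2] at h
  linarith

/-- Positive height rescales to a tropical point. At height zero only the origin remains, which
needs the Nullstellensatz. At negative height, adding a multiple of (1, w) reaches height zero, so
the vector is a multiple of (1, w). -/
theorem IsTropicalPoint.coneFaceAt_subset_bergmanFan {J : Δ.Ray → Fin c}
    (hJ : IsNefPartition J) {g : Fin c → Δ.CoxRing} (hg : ∀ j, IsGeneralSection J j (g j))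
    {w : Fin n → ℝ} (hw : IsTropicalPoint J w) :
    coneFaceAt J w ⊆ bergmanFan (degenerationIdeal J g) := by
  intro v hv
  rcases lt_trichotomy v.1 0 with h | h | h
  · have h1 := coneFaceAt_add_smul_mem hv hw.mem_coneFaceAt (s := -v.1) (by linarith)
    have h2 : v.2 + (-v.1) • w = 0 := hw.eq_zero_of_mem_coneFaceAt hJ h1 (by simp)
    refine hw.smul_mem_bergmanFan hJ hg h.ne ?_ hv.1
    refine Prod.ext (by simp) ?_
    rw [neg_smul] at h2
    rw [Prod.smul_snd]
    exact add_neg_eq_zero.1 h2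
  · have h0 : v = 0 := Prod.ext h (hw.eq_zero_of_mem_coneFaceAt hJ hv h)
    rw [h0]
    exact zero_mem_bergmanFan
      (hw.smul_mem_bergmanFan hJ hg one_ne_zero (one_smul ℝ _).symm hw.1)
  · have hmem : ((1 : ℝ), v.1⁻¹ • v.2) ∈ coneFaceAt J w := by
      have h1 := coneFaceAt_add_smul_mem (zero_mem_coneFaceAt J w) hv (inv_nonneg.2 h.le)
      have h2 : (0 : ℝ × (Fin n → ℝ)) + v.1⁻¹ • v = ((1 : ℝ), v.1⁻¹ • v.2) := by
        rw [zero_add]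
        exact Prod.ext (inv_mul_cancel₀ h.ne') rfl
      rwa [h2] at h1
    refine (hw.of_mem_coneFaceAt hmem).smul_mem_bergmanFan hJ hg h.ne' ?_ hv.1
    refine Prod.ext (by simp) ?_
    rw [Prod.smul_snd, smul_smul, mul_inv_cancel₀ h.ne', one_smul]

/-- The sum of the forms tight at `w` is non-negative on the cone and vanishes exactly where each of
them does. The point (1, 0) of the cone shows that the face is proper. -/
theorem IsTropicalPoint.isBoundaryFace_coneFaceAt {J : Δ.Ray → Fin c} {w : Fin n → ℝ}
    (hw : IsTropicalPoint J w) : IsBoundaryFace (specialCone J) (coneFaceAt J w) := by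
  classical
  have hfin : ∀ j, {m ∈ generalPoints J j | realVec m ⬝ᵥ w = -1}.Finite := fun j =>
    (finite_sectionPoints J j).subset fun m hm => hm.1.1
  set L : (ℝ × (Fin n → ℝ)) →ₗ[ℝ] ℝ := ∑ j, ∑ m ∈ (hfin j).toFinset,
    (LinearMap.fst ℝ ℝ (Fin n → ℝ) +
      (dotProductEquiv ℝ (Fin n) (realVec m)) ∘ₗ LinearMap.snd ℝ ℝ (Fin n → ℝ)) with hL
  have hLv : ∀ v, L v = ∑ j, ∑ m ∈ (hfin j).toFinset, (v.1 + realVec m ⬝ᵥ v.2) := by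
    intro v
    simp [hL, LinearMap.sum_apply]
  have hnn : ∀ v ∈ specialCone J, ∀ j, ∀ m ∈ (hfin j).toFinset, 0 ≤ v.1 + realVec m ⬝ᵥ v.2 :=
    fun v hv j m hm => hv j m ((hfin j).mem_toFinset.1 hm).1
  have hLnn : ∀ v ∈ specialCone J, 0 ≤ L v := fun v hv => by
    rw [hLv]
    exact Finset.sum_nonneg fun j _ => Finset.sum_nonneg (hnn v hv j)
  refine ⟨fun _ => ⟨LinearMap.toContinuousLinearMap (-L), ?_⟩, ⟨_, hw.mem_coneFaceAt⟩,
    fun heq => ?_⟩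
  · ext v
    simp only [LinearMap.coe_toContinuousLinearMap', LinearMap.neg_apply, neg_le_neg_iff]
    constructor
    · rintro ⟨hv, hvw⟩
      refine ⟨hv, fun y hy => ?_⟩
      have : L v = 0 := by
        rw [hLv]
        refine Finset.sum_eq_zero fun j _ => Finset.sum_eq_zero fun m hm => ?_
        obtain ⟨h1, h2⟩ := (hfin j).mem_toFinset.1 hm
        exact hvw j m h1 h2
      rw [this]
      exact hLnn y hy
    · rintro ⟨hv, hmin⟩
      refine ⟨hv, fun j m hm hmw => ?_⟩
      have h0 : L v = 0 := by
        refine le_antisymm ?_ (hLnn v hv)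
        have := hmin 0 (zero_mem_coneFaceAt J w).1
        rwa [map_zero] at this
      rw [hLv] at h0
      have h1 := (Finset.sum_eq_zero_iff_of_nonneg fun j _ => Finset.sum_nonneg (hnn v hv j)).1
        h0 j (Finset.mem_univ j)
      exact (Finset.sum_eq_zero_iff_of_nonneg (hnn v hv j)).1 h1 m
        ((hfin j).mem_toFinset.2 ⟨hm, hmw⟩)
  · obtain ⟨r⟩ := nonempty_ray Δ
    obtain ⟨m, hm, hmw⟩ := hw.2 (J r)
    have h1 : ((1 : ℝ), (0 : Fin n → ℝ)) ∈ coneFaceAt J w := by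
      rw [heq]
      intro j m _
      simp
    have h2 := h1.2 (J r) m hm hmw
    simp at h2

end ReflexivePolytope

end

/-! ### Assembly of the bijections. -/

theorem mainTheorem1 {n c : ℕ} (Δ : ReflexivePolytope n)
    (J : Δ.Ray → Fin c) (hJ : ReflexivePolytope.IsNefPartition J)
    (g : Fin c → Δ.CoxRing) (hg : ∀ j, ReflexivePolytope.IsGeneralSection J j (g j))
    (lt : (Option Δ.Ray →₀ ℕ) → (Option Δ.Ray →₀ ℕ) → Prop)
    (hlt : IsMonomialOrdering lt) (hlocal : lt (Finsupp.single none 1) 0)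
    (I₀ : Ideal Δ.CoxRing) (hI₀ : I₀ = ReflexivePolytope.specialFibreIdeal J)
    (I : Ideal Δ.FamilyRing) (hI : I = ReflexivePolytope.degenerationIdeal J g)
    (nabla : Set (Fin n → ℝ)) (hnabla : nabla = ReflexivePolytope.weightPolytope lt I₀ I)
    (T : Set (Set (Fin n → ℝ))) (hT : T = ReflexivePolytope.tropicalComplex lt I₀ I)
    (T' : Set (Set (Fin n → ℝ))) (hT' : T' = dualFace nabla '' T) :
    Set.BijOn (dualFace nabla) T T' ∧
    (∀ F₁ ∈ T, ∀ F₂ ∈ T, F₁ ⊆ F₂ ↔ dualFace nabla F₂ ⊆ dualFace nabla F₁) ∧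
    Set.BijOn (ReflexivePolytope.minkowskiMap J) T' (ReflexivePolytope.strata I₀) ∧
    (∀ E₁ ∈ T', ∀ E₂ ∈ T', E₁ ⊆ E₂ ↔
      ReflexivePolytope.minkowskiMap J E₁ ⊆ ReflexivePolytope.minkowskiMap J E₂) ∧
    Set.BijOn (fun F => ReflexivePolytope.minkowskiMap J (dualFace nabla F)) T
      (ReflexivePolytope.strata I₀) ∧
    (∀ F₁ ∈ T, ∀ F₂ ∈ T, F₁ ⊆ F₂ ↔
      ReflexivePolytope.minkowskiMap J (dualFace nabla F₂) ⊆
        ReflexivePolytope.minkowskiMap J (dualFace nabla F₁)) := by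
  open ReflexivePolytope in
  subst hI₀ hI
  have hcone := hJ.groebnerCone_eq hg hlt
  replace hnabla : nabla = {w | ((1 : ℝ), w) ∈ specialCone J} := by
    rw [hnabla, weightPolytope, hcone]
  have hslice : ∀ F ∈ T, ∃ C, IsExposed ℝ (specialCone J) C ∧
      F = {w | ((1 : ℝ), w) ∈ C} ∧ IsTropicalSlice J F := by
    rw [hT]
    rintro F ⟨hne, C, ⟨hC, hBF⟩, rfl⟩
    rw [hcone] at hC
    exact ⟨C, hC.1, rfl, isTropicalSlice_of_subset_bergmanFan hg hC.1 hBF hne⟩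
  have hmink : ∀ F ∈ T, minkowskiMap J (dualFace nabla F)
      = {x ∈ Δ.carrier | ∀ w ∈ F, x ⬝ᵥ w = -c} := by
    intro F hF
    obtain ⟨C, -, -, hFs⟩ := hslice F hF
    rw [hnabla, hFs.minkowskiMap_eq hJ]
  -- Both maps are monotone for formal reasons. The converse `hback` for the composite closes the
  -- circle, so both factors inherit injectivity and the reverse implications from it.
  have hdual : ∀ F₁ F₂ : Set (Fin n → ℝ), F₁ ⊆ F₂ → dualFace nabla F₂ ⊆ dualFace nabla F₁ :=
    fun F₁ F₂ h x hx => ⟨hx.1, fun w hw => hx.2 w (h hw)⟩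
  have hmono : ∀ E₁ E₂ : Set (Fin n → ℝ), E₁ ⊆ E₂ → minkowskiMap J E₁ ⊆ minkowskiMap J E₂ :=
    fun E₁ E₂ h => Set.finsetSum_subset_finsetSum _ _ _
      fun j _ => Set.inter_subset_inter_left _ h
  have hback : ∀ F₁ ∈ T, ∀ F₂ ∈ T,
      minkowskiMap J (dualFace nabla F₂) ⊆ minkowskiMap J (dualFace nabla F₁) → F₁ ⊆ F₂ := by
    intro F₁ h₁ F₂ h₂ h
    rw [hmink F₁ h₁, hmink F₂ h₂] at h
    obtain ⟨-, -, -, hF₁⟩ := hslice F₁ h₁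
    obtain ⟨C, hC, rfl, hF₂⟩ := hslice F₂ h₂
    exact hF₁.subset_of_subset hJ hC hF₂ h
  have hmaps : ∀ F ∈ T, minkowskiMap J (dualFace nabla F) ∈ strata (specialFibreIdeal J) := by
    intro F hF
    rw [hmink F hF]
    obtain ⟨-, -, -, hFs⟩ := hslice F hF
    obtain ⟨w₀, hw₀, hgen⟩ := hFs.exists_generic hJ
    rw [hFs.eq_of_generic hJ hw₀ fun j m hm => hgen j m hm.1]
    exact (hFs.isTropicalPoint hw₀).face_mem_strata hJ
  have hsurj : ∀ G ∈ strata (specialFibreIdeal J), ∃ F ∈ T,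
      minkowskiMap J (dualFace nabla F) = G := by
    intro G hG
    obtain ⟨w, hw, rfl⟩ := exists_isTropicalPoint_of_mem_strata hJ hG
    have hBF := hw.coneFaceAt_subset_bergmanFan hJ hg
    have hne : {v | ((1 : ℝ), v) ∈ coneFaceAt J w}.Nonempty := ⟨w, hw.mem_coneFaceAt⟩
    have hbd := hw.isBoundaryFace_coneFaceAt
    have hF : {v | ((1 : ℝ), v) ∈ coneFaceAt J w} ∈ T := by
      rw [hT]
      refine ⟨hne, _, ⟨?_, hBF⟩, rfl⟩
      rw [hcone]
      exact hbd
    refine ⟨_, hF, ?_⟩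
    rw [hmink _ hF]
    -- By construction of `coneFaceAt`, the point `w` itself is generic in its slice.
    refine (isTropicalSlice_of_subset_bergmanFan hg hbd.1 hBF hne).eq_of_generic hJ
      hw.mem_coneFaceAt fun j m hm hmw v hv => ?_
    have h : (1 : ℝ) + realVec m ⬝ᵥ v = 0 := hv.2 j m hm hmw
    linarith
  have hinj : ∀ F₁ ∈ T, ∀ F₂ ∈ T,
      minkowskiMap J (dualFace nabla F₁) = minkowskiMap J (dualFace nabla F₂) → F₁ = F₂ :=
    fun F₁ h₁ F₂ h₂ h => Set.Subset.antisymm (hback F₁ h₁ F₂ h₂ h.ge) (hback F₂ h₂ F₁ h₁ h.le)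
  subst hT'
  refine ⟨⟨Set.mapsTo_image _ _, fun F₁ h₁ F₂ h₂ h => hinj F₁ h₁ F₂ h₂ (congrArg _ h),
      Set.surjOn_image _ _⟩,
    fun F₁ h₁ F₂ h₂ => ⟨hdual F₁ F₂, fun h => hback F₁ h₁ F₂ h₂ (hmono _ _ h)⟩,
    ⟨?_, ?_, ?_⟩, ?_, ⟨hmaps, fun F₁ h₁ F₂ h₂ h => hinj F₁ h₁ F₂ h₂ h, hsurj⟩,
    fun F₁ h₁ F₂ h₂ => ⟨fun h => hmono _ _ (hdual F₁ F₂ h), hback F₁ h₁ F₂ h₂⟩⟩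
  · rintro _ ⟨F, hF, rfl⟩
    exact hmaps F hF
  · rintro _ ⟨F₁, h₁, rfl⟩ _ ⟨F₂, h₂, rfl⟩ h
    rw [hinj F₁ h₁ F₂ h₂ h]
  · intro G hG
    obtain ⟨F, hF, h⟩ := hsurj G hG
    exact ⟨_, ⟨F, hF, rfl⟩, h⟩
  · rintro _ ⟨F₁, h₁, rfl⟩ _ ⟨F₂, h₂, rfl⟩
    exact ⟨hmono _ _, fun h => hdual F₂ F₁ (hback F₂ h₂ F₁ h₁ h)⟩
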